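/- Fix $n\ge 0$ and $u\in\mathbb C$. The spin symmetric group algebra $\mathbb CS_n^-$ is the $\mathbb C$-algebra generated by $t_1,\dots,t_{n-1}$ with relations $t_i^2=1$, $t_it_{i+1}t_i=t_{i+1}t_it_{i+1}$, and $t_it_j=-t_jt_i$ for $|i-j|>1$. For $i<j$ put $[i,j]=-[j,i]=(-1)^{j-i-1}t_{j-1}\cdots t_{i+1}t_it_{i+1}\cdots t_{j-1}$. The rational spin double affine Hecke algebra $\ddot H^-$ is the superalgebra generated by $\xi_i,y_i$ ($1\le i\le n$) and $t_i$ ($1\le i\le n-1$), where $y_i$ is even and $\xi_i,t_i$ are odd, subject to the above relations for the $t_i$ and $$\xi_i\xi_j=-\xi_j\xi_i,\quad y_iy_j=y_jy_i\ (i\ne j),\qquad t_i\xi_i=-\xi_{i+1}t_i,\quad t_iy_i=y_{i+1}t_i,$$ $$t_j\xi_i=-\xi_it_j,\quad t_jy_i=y_it_j\ (i\neq j,j+1),\qquad [y_i,\xi_j]=u[i,j]\ (i\ne j),\quad [y_i,\xi_i]=u\sum_{k\ne i}[i,k].$$ The trigonometric spin double affine Hecke algebra $\ddot H^-_{tr}$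 is the superalgebra generated by $e^{\pm\epsilon_i},\zeta_i$ ($1\le i\le n$) and $t_i$ ($1\le i\le n-1$), where $e^{\pm\epsilon_i}$ is even and $\zeta_i,t_i$ are odd, subject to the above relations for the $t_i$ and $$e^{\epsilon_i}e^{-\epsilon_i}=e^{-\epsilon_i}e^{\epsilon_i}=1,\quad e^{\epsilon_i}e^{\epsilon_j}=e^{\epsilon_j}e^{\epsilon_i},\qquad t_ie^{\epsilon_i}=e^{\epsilon_{i+1}}t_i,\quad t_ie^{\epsilon_j}=e^{\epsilon_j}t_i\ (j\ne i,i+1),$$ $$\zeta_{i+1}t_i+t_i\zeta_i=u,\quad \zeta_jt_i=-t_i\zeta_j\ (j\neq i,i+1),\qquad \zeta_i\zeta_j=-\zeta_j\zeta_i\ (i\ne j),$$ $$[\zeta_i,e^\eta]=u\sum_{k\neq i}\operatorname{sgn}(k-i)\,\frac{e^\eta-e^{s_{ki}(\eta)}}{1-e^{\operatorname{sgn}(k-i)(\epsilon_k-\epsilon_i)}}\,[k,i]\qquad\Bigl(\eta\in P=\bigoplus_{i=1}^n\mathbb Z\epsilon_i\Bigr),$$ where $e^\eta=\prod_i(e^{\epsilon_i})^{\eta_i}$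 for $\eta=\sum_i\eta_i\epsilon_i$, the transposition $s_{ki}$ acts on $P$ by interchanging $\epsilon_k$ and $\epsilon_i$, and the quotients are taken in the Laurent polynomial ring $\mathbb C[P]$. **Theorem.** (1) There exists a unique homomorphism of superalgebras $\iota^-:\ddot H^-\to\ddot H^-_{tr}$ which is the identity on $\mathbb CS_n^-$ (that is, commutes with the canonical maps $t_i\mapsto t_i$ from $\mathbb CS_n^-$ to both algebras) and satisfies $$\iota^-(y_i)=e^{\epsilon_i},\qquad \iota^-(\xi_i)=e^{-\epsilon_i}\Bigl(\zeta_i-u\sum_{k<i}[k,i]\Bigr)\qquad(1\le i\le n).$$ Moreover, $\iota^-$ is injective. (2) Let $\mathbb C[y]=\mathbb C[y_1,\dots,y_n]$ act on $\ddot H^-$ by left multiplication and let $\mathbb C[y^{\pm}]=\mathbb C[y_1^{\pm1},\dots,y_n^{\pm1}]$. The vector space $\mathbb C[y^\pm]\otimes_{\mathbb C[y]}\ddot H^-$ has a unique structure of associative $\mathbb C$-algebra with unit $1\otimes1$ such that $f\mapsto f\otimes1$ and $h\mapsto1\otimes h$ are multiplicative and $(f\otimes1)(1\otimes h)=f\otimes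 h$. With this structure, $\iota^-$ extends to an algebra isomorphism $$\mathbb C[y^\pm]\otimes_{\mathbb C[y]}\ddot H^-\ \stackrel{\cong}{\longrightarrow}\ \ddot H^-_{tr}$$ (its composite with $h\mapsto 1\otimes h$ is $\iota^-$), whose inverse $j^-$ is the identity on $\mathbb CS_n^-$ and satisfies $$j^-(e^{\epsilon_i})=y_i,\qquad j^-(\zeta_i)=y_i\xi_i+u\sum_{k<i}[k,i]\qquad(1\le i\le n),$$ where $h\in\ddot H^-$ is written for $1\otimes h$. -/

import Mathlib

open scoped TensorProduct

noncomputable section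

namespace SpinDaha

/-! ### The spin symmetric group algebra -/

/-- The first of the two neighbouring positions `i`, `i + 1` (0-based) interchanged by `t_i`. -/
def lo {n : ℕ} (i : Fin (n - 1)) : Fin n := ⟨i, by omega⟩

/-- The second of the two neighbouring positions `i`, `i + 1` interchanged by `t_i`. -/
def hi {n : ℕ} (i : Fin (n - 1)) : Fin n := ⟨i + 1, by omega⟩

/-- `oddTranspAux t i d = [i, i + d + 1] = (-1)^d t_{i+d} ⋯ t_{i+1} t_i t_{i+1} ⋯ t_{i+d}`. -/
def oddTranspAux {A : Type*} [Ring A] (t : ℕ → A) (i : ℕ) : ℕ → A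
  | 0 => t i
  | d + 1 => -(t (i + d + 1) * oddTranspAux t i d * t (i + d + 1))

/-- The odd transposition `[i, j]` formed from elements `t_1, …, t_{n-1}` of a ring:
`[i, j] = -[j, i] = (-1)^{j-i-1} t_{j-1} ⋯ t_{i+1} t_i t_{i+1} ⋯ t_{j-1}` for `i < j`.
(The value for `i = j` is never used.) -/
def oddTransp {A : Type*} [Ring A] {n : ℕ} (t : Fin (n - 1) → A) (i j : Fin n) : A :=
  let t' : ℕ → A := fun k => if h : k < n - 1 then t ⟨k, h⟩ else 0
  if i < j then oddTranspAux t' i ((j : ℕ) - i - 1)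
  else if j < i then -oddTranspAux t' j ((i : ℕ) - j - 1)
  else 0

/-- The defining relations of the spin symmetric group algebra. -/
inductive SpinSymRel {A : Type*} [Ring A] {n : ℕ} (t : Fin (n - 1) → A) : A → A → Prop
  | sq (i : Fin (n - 1)) : SpinSymRel t (t i * t i) 1
  | braid (i j : Fin (n - 1)) (h : (i : ℕ) + 1 = j) : SpinSymRel t (t i * t j * t i) (t j * t i * t j)
  | anticomm (i j : Fin (n - 1)) (h : (i : ℕ) + 1 < j ∨ (j : ℕ) + 1 < i) :
      SpinSymRel t (t i * t j) (-(t j * t i))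

/-- The spin symmetric group algebra `ℂ S_n^-`. -/
def SpinSym (n : ℕ) : Type :=
  RingQuot (SpinSymRel (n := n) (FreeAlgebra.ι ℂ : Fin (n - 1) → FreeAlgebra ℂ (Fin (n - 1))))

instance (n : ℕ) : Ring (SpinSym n) := inferInstanceAs (Ring (RingQuot _))

instance (n : ℕ) : Algebra ℂ (SpinSym n) := inferInstanceAs (Algebra ℂ (RingQuot _))

/-- The generator `t_i` of `ℂ S_n^-`. -/
def SpinSym.t {n : ℕ} (i : Fin (n - 1)) : SpinSym n :=
  RingQuot.mkAlgHom ℂ _ (FreeAlgebra.ι ℂ i)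

/-- The algebra homomorphism from `ℂ S_n^-` given by elements satisfying its relations. -/
def SpinSym.lift {n : ℕ} {A : Type*} [Ring A] [Algebra ℂ A] (t : Fin (n - 1) → A)
    (h : ∀ a b, SpinSymRel t a b → a = b) : SpinSym n →ₐ[ℂ] A :=
  RingQuot.liftAlgHom ℂ ⟨FreeAlgebra.lift ℂ t, by
    intro a b hab
    cases hab with
    | sq i => simpa using h _ _ (.sq i)
    | braid i j hij => simpa using h _ _ (.braid i j hij)
    | anticomm i j hij => simpa using h _ _ (.anticomm i j hij)⟩

theorem SpinSym.lift_t {n : ℕ} {A : Type*} [Ring A] [Algebra ℂ A] (t : Fin (n - 1) → A)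
    (h : ∀ a b, SpinSymRel t a b → a = b) (i : Fin (n - 1)) :
    SpinSym.lift t h (SpinSym.t i) = t i := by
  unfold SpinSym.lift SpinSym.t
  erw [RingQuot.liftAlgHom_mkAlgHom_apply]
  simp

/-- Algebra homomorphisms preserve the relations of `ℂ S_n^-`. -/
theorem SpinSymRel.map {n : ℕ} {A B : Type*} [Ring A] [Algebra ℂ A] [Ring B] [Algebra ℂ B]
    (f : A →ₐ[ℂ] B) {t : Fin (n - 1) → A} (hf : ∀ a b, SpinSymRel t a b → f a = f b) :
    ∀ a b, SpinSymRel (fun i => f (t i)) a b → a = b := by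
  intro a b hab
  cases hab with
  | sq i => simpa using hf _ _ (.sq i)
  | braid i j hij => simpa using hf _ _ (.braid i j hij)
  | anticomm i j hij => simpa using hf _ _ (.anticomm i j hij)

/-! ### Parity -/

/-- For an algebra with generators `g x` that are declared to be homogeneous of parity `p x`, the
homogeneous component of parity `d`: the span of all words in the generators of total parity `d`. -/
def parityPart {A X : Type*} [Ring A] [Algebra ℂ A] (g : X → A) (p : X → ZMod 2) (d : ZMod 2) :
    Submodule ℂ A :=
  Submodule.span ℂ {a | ∃ w : List X, (w.map p).sum = d ∧ a = (w.map g).prod}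

/-! ### The rational spin double affine Hecke algebra -/

/-- Generators `ξ_i`, `y_i`, `t_i`. -/
inductive RatGen (n : ℕ) : Type
  | xi (i : Fin n)
  | y (i : Fin n)
  | t (i : Fin (n - 1))

/-- The generators `ξ_i` and `t_i` are odd, the `y_i` are even. -/
def RatGen.parity {n : ℕ} : RatGen n → ZMod 2
  | xi _ => 1
  | y _ => 0
  | t _ => 1

section Rational

/-- Generators in the free algebra. -/
def fxi {n : ℕ} (i : Fin n) : FreeAlgebra ℂ (RatGen n) := FreeAlgebra.ι ℂ (.xi i)

/-- Generators in the free algebra. -/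
def fy {n : ℕ} (i : Fin n) : FreeAlgebra ℂ (RatGen n) := FreeAlgebra.ι ℂ (.y i)

/-- Generators in the free algebra. -/
def ft {n : ℕ} (i : Fin (n - 1)) : FreeAlgebra ℂ (RatGen n) := FreeAlgebra.ι ℂ (.t i)

/-- The defining relations of the rational spin double affine Hecke algebra. -/
inductive RatRel (n : ℕ) (u : ℂ) : FreeAlgebra ℂ (RatGen n) → FreeAlgebra ℂ (RatGen n) → Prop
  | spin {a b} (h : SpinSymRel ft a b) : RatRel n u a b
  | xi_xi (i j : Fin n) (h : i ≠ j) : RatRel n u (fxi i * fxi j) (-(fxi j * fxi i))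
  | y_y (i j : Fin n) (h : i ≠ j) : RatRel n u (fy i * fy j) (fy j * fy i)
  | t_xi (i : Fin (n - 1)) : RatRel n u (ft i * fxi (lo i)) (-(fxi (hi i) * ft i))
  | t_y (i : Fin (n - 1)) : RatRel n u (ft i * fy (lo i)) (fy (hi i) * ft i)
  | t_xi' (j : Fin (n - 1)) (i : Fin n) (h : i ≠ lo j) (h' : i ≠ hi j) :
      RatRel n u (ft j * fxi i) (-(fxi i * ft j))
  | t_y' (j : Fin (n - 1)) (i : Fin n) (h : i ≠ lo j) (h' : i ≠ hi j) :
      RatRel n u (ft j * fy i) (fy i * ft j)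
  | y_xi (i j : Fin n) (h : i ≠ j) :
      RatRel n u (fy i * fxi j - fxi j * fy i) (u • oddTransp ft i j)
  | y_xi_self (i : Fin n) :
      RatRel n u (fy i * fxi i - fxi i * fy i)
        (u • ∑ k ∈ Finset.univ.filter (fun k => k ≠ i), oddTransp ft i k)

end Rational

/-- The rational spin double affine Hecke algebra with parameter `u`. -/
def RatDaha (n : ℕ) (u : ℂ) : Type := RingQuot (RatRel n u)

instance (n : ℕ) (u : ℂ) : Ring (RatDaha n u) := inferInstanceAs (Ring (RingQuot _))

instance (n : ℕ) (u : ℂ) : Algebra ℂ (RatDaha n u) := inferInstanceAs (Algebra ℂ (RingQuot _))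

namespace RatDaha

variable (n : ℕ) (u : ℂ)

/-- The quotient map from the free algebra. -/
def mk : FreeAlgebra ℂ (RatGen n) →ₐ[ℂ] RatDaha n u := RingQuot.mkAlgHom ℂ (RatRel n u)

theorem mk_rel {a b : FreeAlgebra ℂ (RatGen n)} (h : RatRel n u a b) : mk n u a = mk n u b :=
  RingQuot.mkAlgHom_rel ℂ h

variable {n}

/-- The images of the generators. -/
def gen (g : RatGen n) : RatDaha n u := mk n u (FreeAlgebra.ι ℂ g)

/-- The generator `ξ_i`. -/
def xi (i : Fin n) : RatDaha n u := gen u (.xi i)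

/-- The generator `y_i`. -/
def y (i : Fin n) : RatDaha n u := gen u (.y i)

/-- The generator `t_i`. -/
def t (i : Fin (n - 1)) : RatDaha n u := gen u (.t i)

/-- The even (`d = 0`) and odd (`d = 1`) parts. -/
def part (d : ZMod 2) : Submodule ℂ (RatDaha n u) := parityPart (gen u) RatGen.parity d

/-- The canonical homomorphism `ℂ S_n^- → RatDaha n u`, `t_i ↦ t_i`. -/
def ofSpin : SpinSym n →ₐ[ℂ] RatDaha n u :=
  SpinSym.lift (t u) (SpinSymRel.map (mk n u) (fun _ _ h => mk_rel n u (.spin h)))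

theorem y_comm (i j : Fin n) : y u i * y u j = y u j * y u i := by
  by_cases h : i = j
  · rw [h]
  · have := mk_rel n u (.y_y i j h)
    rwa [map_mul, map_mul] at this

/-- The homomorphism `ℂ[y_1, …, y_n] → RatDaha n u`, `y_i ↦ y_i`
(it has values in the commutative subalgebra generated by the `y_i`). -/
def polyHom : MvPolynomial (Fin n) ℂ →ₐ[ℂ] RatDaha n u :=
  haveI := Algebra.isMulCommutative_adjoin ℂ (s := Set.range (y (n := n) u)) (by
    rintro _ ⟨i, rfl⟩ _ ⟨j, rfl⟩
    exact y_comm u i j)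
  letI : CommSemiring (Algebra.adjoin ℂ (Set.range (y (n := n) u))) :=
    { (Algebra.adjoin ℂ (Set.range (y (n := n) u))).toSemiring with
      mul_comm := fun a b => mul_comm' a b }
  (Algebra.adjoin ℂ (Set.range (y (n := n) u))).val.comp
    (MvPolynomial.aeval (R := ℂ) (S₁ := Algebra.adjoin ℂ (Set.range (y (n := n) u)))
      fun i => ⟨y u i, Algebra.subset_adjoin ⟨i, rfl⟩⟩)

theorem polyHom_X (i : Fin n) : polyHom u (MvPolynomial.X i) = y u i := by
  simp [polyHom]

/-- `ℂ[y_1, …, y_n]` acts on `RatDaha n u` by left multiplication. -/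
instance : Module (MvPolynomial (Fin n) ℂ) (RatDaha n u) :=
  Module.compHom _ (polyHom (n := n) u).toRingHom

theorem poly_smul_def (f : MvPolynomial (Fin n) ℂ) (h : RatDaha n u) :
    f • h = polyHom u f * h := rfl

end RatDaha

/-! ### The trigonometric spin double affine Hecke algebra -/

/-- Generators `e^{ε_i}`, `e^{-ε_i}`, `ζ_i`, `t_i`. -/
inductive TrigGen (n : ℕ) : Type
  | e (i : Fin n)
  | eInv (i : Fin n)
  | zeta (i : Fin n)
  | t (i : Fin (n - 1))

/-- The generators `ζ_i` and `t_i` are odd, the `e^{±ε_i}` are even. -/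
def TrigGen.parity {n : ℕ} : TrigGen n → ZMod 2
  | e _ => 0
  | eInv _ => 0
  | zeta _ => 1
  | t _ => 1

/-- The group algebra `ℂ[P]` of the lattice `P = ℤ ε_1 ⊕ ⋯ ⊕ ℤ ε_n`. -/
abbrev LatticeAlg (n : ℕ) : Type := AddMonoidAlgebra ℂ (Fin n → ℤ)

/-- The element `e^η` of `ℂ[P]`. -/
def lexp {n : ℕ} (η : Fin n → ℤ) : LatticeAlg n := AddMonoidAlgebra.single η 1

/-- The action of the transposition `s_{ki}` on `P`. -/
def swapAct {n : ℕ} (k i : Fin n) (η : Fin n → ℤ) : Fin n → ℤ := fun l => η (Equiv.swap k i l)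

/-- The sign of `k - i`. -/
def sgn {n : ℕ} (k i : Fin n) : ℤ := Int.sign ((k : ℤ) - (i : ℤ))

/-- `q` is the quotient `(e^η - e^{s_{ki} η}) / (1 - e^{sgn(k-i)(ε_k - ε_i)})` in `ℂ[P]`. -/
def IsDivDiff {n : ℕ} (k i : Fin n) (η : Fin n → ℤ) (q : LatticeAlg n) : Prop :=
  q * (1 - lexp (sgn k i • (Pi.single k 1 - Pi.single i 1))) = lexp η - lexp (swapAct k i η)

theorem lexp_mul {n : ℕ} (η θ : Fin n → ℤ) : lexp η * lexp θ = lexp (η + θ) := by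
  simp [lexp, AddMonoidAlgebra.single_mul_single]

/-- The quotient exists and is unique. -/
theorem existsUnique_isDivDiff {n : ℕ} (k i : Fin n) (h : k ≠ i) (η : Fin n → ℤ) :
    ∃! q, IsDivDiff k i η q := by
  set α : Fin n → ℤ := sgn k i • (Pi.single k 1 - Pi.single i 1) with hα
  have hs : sgn k i * sgn k i = 1 := by
    have : (k : ℤ) - i ≠ 0 := by
      intro hh; exact h (Fin.ext (by omega))
    unfold sgn
    rcases Int.lt_or_gt_of_ne this with h1 | h1
    · rw [Int.sign_eq_neg_one_of_neg h1]; rfl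
    · rw [Int.sign_eq_one_of_pos h1]; rfl
  have hα0 : α ≠ 0 := by
    intro h0
    have := congrFun h0 k
    simp [hα, h] at this
    simp [this] at hs
  have hne : (1 : LatticeAlg n) - lexp α ≠ 0 := by
    intro h0
    have h1 : AddMonoidAlgebra.single (0 : Fin n → ℤ) (1 : ℂ) = AddMonoidAlgebra.single α 1 :=
      sub_eq_zero.mp h0
    have h2 := congrArg (fun x : LatticeAlg n => x.coeff α) h1
    simp [hα0.symm] at h2
  have hswap : swapAct k i η = η + (sgn k i * (η i - η k)) • α := by
    funext l
    have e1 : ((sgn k i * (η i - η k)) • α) l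
        = (η i - η k) * ((Pi.single k 1 : Fin n → ℤ) l - (Pi.single i 1 : Fin n → ℤ) l) := by
      simp only [hα, Pi.smul_apply, Pi.sub_apply, smul_eq_mul]
      linear_combination (η i - η k) * ((Pi.single k 1 : Fin n → ℤ) l
        - (Pi.single i 1 : Fin n → ℤ) l) * hs
    rw [Pi.add_apply, e1]
    unfold swapAct
    by_cases hl : l = k
    · subst hl; simp [h]
    · by_cases hl' : l = i
      · subst hl'; simp [hl]
      · simp [Equiv.swap_apply_of_ne_of_ne hl hl', hl, hl']
  have key : ∀ (m : ℕ) (θ : Fin n → ℤ),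
      ∃ q : LatticeAlg n, q * (1 - lexp α) = lexp θ - lexp (θ + (m : ℤ) • α) := by
    intro m θ
    induction m with
    | zero => exact ⟨0, by simp⟩
    | succ m ih =>
      obtain ⟨q, hq⟩ := ih
      refine ⟨q + lexp (θ + (m : ℤ) • α), ?_⟩
      rw [add_mul, hq, mul_sub, mul_one, lexp_mul]
      have : θ + ((m + 1 : ℕ) : ℤ) • α = θ + (m : ℤ) • α + α := by
        push_cast; rw [add_smul, one_smul, add_assoc]
      rw [this]; abel
  have hex : ∃ q, IsDivDiff k i η q := by
    unfold IsDivDiff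
    rw [hswap]
    generalize sgn k i * (η i - η k) = z
    rcases Int.eq_nat_or_neg z with ⟨m, rfl | rfl⟩
    · exact key m η
    · obtain ⟨q, hq⟩ := key m (η + (-(m : ℤ)) • α)
      refine ⟨-q, ?_⟩
      rw [neg_mul, hq]
      simp
  obtain ⟨q, hq⟩ := hex
  refine ⟨q, hq, fun q' hq' => ?_⟩
  exact mul_right_cancel₀ hne (hq'.trans hq.symm)

section Trigonometric

/-- Generators in the free algebra. -/
def ge {n : ℕ} (i : Fin n) : FreeAlgebra ℂ (TrigGen n) := FreeAlgebra.ι ℂ (.e i)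

/-- Generators in the free algebra. -/
def geInv {n : ℕ} (i : Fin n) : FreeAlgebra ℂ (TrigGen n) := FreeAlgebra.ι ℂ (.eInv i)

/-- Generators in the free algebra. -/
def gzeta {n : ℕ} (i : Fin n) : FreeAlgebra ℂ (TrigGen n) := FreeAlgebra.ι ℂ (.zeta i)

/-- Generators in the free algebra. -/
def gt {n : ℕ} (i : Fin (n - 1)) : FreeAlgebra ℂ (TrigGen n) := FreeAlgebra.ι ℂ (.t i)

/-- `e^η = ∏_i (e^{ε_i})^{η_i}` as a word in the generators `e^{±ε_i}`. -/
def gexp {n : ℕ} (η : Fin n → ℤ) : FreeAlgebra ℂ (TrigGen n) :=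
  (List.ofFn fun i => ge i ^ (η i).toNat * geInv i ^ (-η i).toNat).prod

/-- An element of `ℂ[P]` written out in the generators `e^{±ε_i}`. -/
def glat {n : ℕ} (q : LatticeAlg n) : FreeAlgebra ℂ (TrigGen n) :=
  q.coeff.sum fun η a => a • gexp η

/-- The defining relations of the trigonometric spin double affine Hecke algebra. -/
inductive TrigRel (n : ℕ) (u : ℂ) : FreeAlgebra ℂ (TrigGen n) → FreeAlgebra ℂ (TrigGen n) → Prop
  | spin {a b} (h : SpinSymRel gt a b) : TrigRel n u a b
  | e_eInv (i : Fin n) : TrigRel n u (ge i * geInv i) 1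
  | eInv_e (i : Fin n) : TrigRel n u (geInv i * ge i) 1
  | e_e (i j : Fin n) : TrigRel n u (ge i * ge j) (ge j * ge i)
  | t_e (i : Fin (n - 1)) : TrigRel n u (gt i * ge (lo i)) (ge (hi i) * gt i)
  | t_e' (i : Fin (n - 1)) (j : Fin n) (h : j ≠ lo i) (h' : j ≠ hi i) :
      TrigRel n u (gt i * ge j) (ge j * gt i)
  | zeta_t (i : Fin (n - 1)) :
      TrigRel n u (gzeta (hi i) * gt i + gt i * gzeta (lo i)) (algebraMap ℂ _ u)
  | zeta_t' (i : Fin (n - 1)) (j : Fin n) (h : j ≠ lo i) (h' : j ≠ hi i) :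
      TrigRel n u (gzeta j * gt i) (-(gt i * gzeta j))
  | zeta_zeta (i j : Fin n) (h : i ≠ j) : TrigRel n u (gzeta i * gzeta j) (-(gzeta j * gzeta i))
  | zeta_exp (i : Fin n) (η : Fin n → ℤ) (q : Fin n → LatticeAlg n)
      (hq : ∀ k, k ≠ i → IsDivDiff k i η (q k)) :
      TrigRel n u (gzeta i * gexp η - gexp η * gzeta i)
        (u • ∑ k ∈ Finset.univ.filter (fun k => k ≠ i),
          (sgn k i : ℂ) • (glat (q k) * oddTransp gt k i))

end Trigonometric

/-- The trigonometric spin double affine Hecke algebra with parameter `u`. -/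
def TrigDaha (n : ℕ) (u : ℂ) : Type := RingQuot (TrigRel n u)

instance (n : ℕ) (u : ℂ) : Ring (TrigDaha n u) := inferInstanceAs (Ring (RingQuot _))

instance (n : ℕ) (u : ℂ) : Algebra ℂ (TrigDaha n u) := inferInstanceAs (Algebra ℂ (RingQuot _))

namespace TrigDaha

variable (n : ℕ) (u : ℂ)

/-- The quotient map from the free algebra. -/
def mk : FreeAlgebra ℂ (TrigGen n) →ₐ[ℂ] TrigDaha n u := RingQuot.mkAlgHom ℂ (TrigRel n u)

theorem mk_rel {a b : FreeAlgebra ℂ (TrigGen n)} (h : TrigRel n u a b) : mk n u a = mk n u b :=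
  RingQuot.mkAlgHom_rel ℂ h

variable {n}

/-- The images of the generators. -/
def gen (g : TrigGen n) : TrigDaha n u := mk n u (FreeAlgebra.ι ℂ g)

/-- The generator `e^{ε_i}`. -/
def e (i : Fin n) : TrigDaha n u := gen u (.e i)

/-- The generator `e^{-ε_i}`. -/
def eInv (i : Fin n) : TrigDaha n u := gen u (.eInv i)

/-- The generator `ζ_i`. -/
def zeta (i : Fin n) : TrigDaha n u := gen u (.zeta i)

/-- The generator `t_i`. -/
def t (i : Fin (n - 1)) : TrigDaha n u := gen u (.t i)

/-- The even (`d = 0`) and odd (`d = 1`) parts. -/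
def part (d : ZMod 2) : Submodule ℂ (TrigDaha n u) := parityPart (gen u) TrigGen.parity d

/-- The canonical homomorphism `ℂ S_n^- → TrigDaha n u`, `t_i ↦ t_i`. -/
def ofSpin : SpinSym n →ₐ[ℂ] TrigDaha n u :=
  SpinSym.lift (t u) (SpinSymRel.map (mk n u) (fun _ _ h => mk_rel n u (.spin h)))

end TrigDaha

/-! ### The homomorphism and the extended algebra -/

/-- The odd Jucys–Murphy element `M_i = ∑_{k < i} [k, i]` of `ℂ S_n^-`. -/
def jucysMurphy {n : ℕ} (i : Fin n) : SpinSym n :=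
  ∑ k ∈ Finset.univ.filter (fun k => k < i), oddTransp SpinSym.t k i

/-- `f` is a homomorphism of superalgebras `RatDaha n u → TrigDaha n u` that is the identity on
`ℂ S_n^-` and maps `y_i ↦ e^{ε_i}`, `ξ_i ↦ e^{-ε_i} (ζ_i - u ∑_{k < i} [k, i])`. -/
structure IsIota {n : ℕ} {u : ℂ} (f : RatDaha n u →ₐ[ℂ] TrigDaha n u) : Prop where
  map_part : ∀ d, (RatDaha.part u d).map f.toLinearMap ≤ TrigDaha.part u d
  map_spin : ∀ s : SpinSym n, f (RatDaha.ofSpin u s) = TrigDaha.ofSpin u s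
  map_y : ∀ i, f (RatDaha.y u i) = TrigDaha.e u i
  map_xi : ∀ i, f (RatDaha.xi u i) =
    TrigDaha.eInv u i * (TrigDaha.zeta u i - u • TrigDaha.ofSpin u (jucysMurphy i))

/-- The Laurent polynomial ring `ℂ[y_1^{±1}, …, y_n^{±1}]`. -/
abbrev Laurent (n : ℕ) : Type :=
  Localization.Away (∏ i : Fin n, (MvPolynomial.X i : MvPolynomial (Fin n) ℂ))

/-- The vector space `ℂ[y^±] ⊗_{ℂ[y]} RatDaha n u`. -/
abbrev LocRat (n : ℕ) (u : ℂ) : Type := Laurent n ⊗[MvPolynomial (Fin n) ℂ] RatDaha n u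

/-- `m` is an associative unital multiplication on `ℂ[y^±] ⊗_{ℂ[y]} RatDaha n u` for which
`ℂ[y^±]` (as `f ↦ f ⊗ 1`) and `RatDaha n u` (as `h ↦ 1 ⊗ h`) are subrings in the sense that these
maps are multiplicative, and `(f ⊗ 1) (1 ⊗ h) = f ⊗ h`. -/
structure IsLocMul {n : ℕ} {u : ℂ} (m : LocRat n u →ₗ[ℂ] LocRat n u →ₗ[ℂ] LocRat n u) : Prop where
  assoc : ∀ a b c, m (m a b) c = m a (m b c)
  one_mul : ∀ a, m (1 ⊗ₜ 1) a = a
  mul_one : ∀ a, m a (1 ⊗ₜ 1) = a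
  left_mul : ∀ f g : Laurent n, m (f ⊗ₜ 1) (g ⊗ₜ 1) = (f * g) ⊗ₜ 1
  right_mul : ∀ h h' : RatDaha n u, m (1 ⊗ₜ h) (1 ⊗ₜ h') = 1 ⊗ₜ (h * h')
  left_mul_right : ∀ (f : Laurent n) (h : RatDaha n u), m (f ⊗ₜ 1) (1 ⊗ₜ h) = f ⊗ₜ h

end SpinDaha

end

/-!
Everything follows from one faithful representation. Let `OddAlg n` be the algebra presented by the
generators `ξ_i`, `t_l` of the rational algebra and the relations among them. On
`RepSpace n = ℂ(y) ⊗ OddAlg n` let `y_i` act by multiplication, `t_l` by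
`f ⊗ a ↦ s_l(f) ⊗ t_l a`, and `ξ_j` by the operator `xiOp`

  `f ⊗ a ↦ f ⊗ ξ_j a - u ∑_k (f - s_{jk} f) / (y_j - y_k) ⊗ [j, k] a`.

These operators satisfy the relations of `RatDaha n u`. The one that is not immediate is
`ξ_i ξ_j = -ξ_j ξ_i`: by the Jacobi identity the anticommutator commutes with all `y_l`, hence with
`ℂ(y)`, and it annihilates `1 ⊗ OddAlg n` (`RepSpace.xiOp_mul_xiOp`). The products `p(y) a` with
`a ∈ OddAlg n` span `RatDaha n u` (`RatDaha.mulMap_surjective`), and applying such a product to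
`1 ⊗ 1` gives `p ⊗ a`; so the representation is faithful (`RepSpace.rep_injective`). In particular
`y_1 ⋯ y_n`, on which all divided differences vanish, is central in `RatDaha n u`
(`RatDaha.commute_polyHom_prodX`).

The relations needed for `ι` are verified in `TrigDaha n u`; the anticommutativity of the images of
the `ξ_i` reduces, by conjugation with the `t_l`, to the first two of them
(`mul_eq_neg_mul_of_first`). Conversely, the operators `y_i ξ_i + u ∑_{k < i} [k, i]` satisfy the
relations of the `ζ_i`, so that `TrigDaha n u` acts on the same space, compatibly with `ι`
(`RepSpace.trigRep_comp_iota`), and `ι` is injective.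

As `y_1 ⋯ y_n` is central and becomes invertible in `TrigDaha n u`, and every generator of
`TrigDaha n u` lies in the image of `ι` after multiplication by it, `ι` is the localization of the
`ℂ[y]`-module `RatDaha n u` at `y_1 ⋯ y_n` (`isLocalizedModule_iotaLin`). So is
`h ↦ 1 ⊗ h`, `RatDaha n u → ℂ[y^±] ⊗ RatDaha n u`; this gives the linear isomorphism `locEquiv`,
along which the product is transported. Centrality of `y_1 ⋯ y_n` also forces the product: it
determines `(1 ⊗ h) (g ⊗ 1)` (`IsLocMul.apply_tmul`).
-/

namespace SpinDaha

/-! ### Odd transpositions -/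

section OddTransp

variable {n : ℕ}

theorem lo_lt_hi (l : Fin (n - 1)) : lo l < hi l := by simp [lo, hi, Fin.lt_def]

theorem lo_ne_hi (l : Fin (n - 1)) : lo l ≠ hi l := (lo_lt_hi l).ne

variable {A : Type*} [Ring A] (t : Fin (n - 1) → A)

theorem oddTransp_self (i : Fin n) : oddTransp t i i = 0 := by simp [oddTransp]

theorem oddTransp_swap (i j : Fin n) : oddTransp t j i = -oddTransp t i j := by
  unfold oddTransp
  rcases lt_trichotomy i j with h | h | h
  · simp [h, h.not_gt]
  · simp [h]
  · simp [h, h.not_gt]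

theorem oddTransp_lo_hi (l : Fin (n - 1)) : oddTransp t (lo l) (hi l) = t l := by
  simp [oddTransp, oddTranspAux, lo, hi]

theorem oddTransp_hi (l : Fin (n - 1)) (i : Fin n) (h : i < lo l) :
    oddTransp t i (hi l) = -(t l * oddTransp t i (lo l) * t l) := by
  obtain ⟨d, hd⟩ : ∃ d, (l : ℕ) = i + d + 1 := ⟨l - i - 1, by
    simp only [lo, Fin.lt_def] at h; omega⟩
  have e1 : ((hi l : Fin n) : ℕ) - i - 1 = d + 1 := by simp only [hi]; omega
  have e2 : ((lo l : Fin n) : ℕ) - i - 1 = d := by simp only [lo]; omega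
  have hl : (i : ℕ) + d + 1 < n - 1 := by have := l.2; omega
  have e3 : (⟨i + d + 1, hl⟩ : Fin (n - 1)) = l := Fin.ext hd.symm
  simp [oddTransp, h, h.trans (lo_lt_hi l), e1, e2, oddTranspAux, hl, e3]

/-- Every odd transposition arises from the simple ones by reversal and by the recursion
`oddTransp_hi`. -/
theorem oddTransp_induction {P : Fin n → Fin n → Prop} (diag : ∀ i, P i i)
    (symm : ∀ i j, P i j → P j i) (base : ∀ l, P (lo l) (hi l))
    (step : ∀ l i, i < lo l → P i (lo l) → P i (hi l)) (i j : Fin n) : P i j := by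
  have key : ∀ (d : ℕ) (i j : Fin n), (i : ℕ) + d + 1 = j → P i j := by
    intro d
    induction d with
    | zero =>
      intro i j h
      have hl : (i : ℕ) < n - 1 := by have := j.2; omega
      have e1 : i = lo ⟨i, hl⟩ := rfl
      have e2 : j = hi ⟨i, hl⟩ := Fin.ext (by simp only [hi]; omega)
      rw [e1, e2]; exact base _
    | succ d ih =>
      intro i j h
      have hl : (i : ℕ) + d + 1 < n - 1 := by have := j.2; omega
      have e2 : j = hi ⟨_, hl⟩ := Fin.ext (by simp only [hi]; omega)
      rw [e2]
      exact step _ _ (by simp only [lo, Fin.lt_def]; omega) (ih _ _ rfl)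
  rcases lt_trichotomy i j with h | h | h
  · exact key (j - i - 1) i j (by rw [Fin.lt_def] at h; omega)
  · subst h; exact diag i
  · exact symm _ _ (key (i - j - 1) j i (by rw [Fin.lt_def] at h; omega))

theorem map_oddTransp {B F : Type*} [Ring B] [FunLike F A B] [RingHomClass F A B] (f : F)
    (i j : Fin n) : f (oddTransp t i j) = oddTransp (fun l => f (t l)) i j := by
  induction i, j using oddTransp_induction with
  | diag i => simp [oddTransp_self]
  | symm i j h => rw [oddTransp_swap, oddTransp_swap (fun l => f (t l)), map_neg, h]
  | base l => simp [oddTransp_lo_hi]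
  | step l i hi h => simp [oddTransp_hi _ _ _ hi, h]

variable {t}

/-- The transposition rule passes from the generators `t_l` to all odd transpositions. The sign
`c` is `1` for even and `-1` for odd elements `x m`. -/
theorem oddTransp_mul_eq_smul {X : Type*} [MulAction (Equiv.Perm (Fin n)) X] (x : X → A) (c : ℤ)
    (hc : c * c = 1) (h : ∀ l m, t l * x m = c • (x (Equiv.swap (lo l) (hi l) • m) * t l))
    (i j : Fin n) (m : X) :
    oddTransp t i j * x m = c • (x (Equiv.swap i j • m) * oddTransp t i j) := by
  induction i, j using oddTransp_induction generalizing m with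
  | diag i => simp [oddTransp_self]
  | symm i j h => rw [oddTransp_swap, Equiv.swap_comm, neg_mul, h, mul_neg, smul_neg]
  | base l => rw [oddTransp_lo_hi, h]
  | step l i hi ih =>
    have e : Equiv.swap i (SpinDaha.hi l) = Equiv.swap (lo l) (SpinDaha.hi l) * Equiv.swap i (lo l)
        * Equiv.swap (lo l) (SpinDaha.hi l) := by
      rw [Equiv.swap_mul_swap_mul_swap hi.ne (hi.trans (lo_lt_hi l)).ne, Equiv.swap_comm]
    rw [oddTransp_hi _ _ _ hi, neg_mul, mul_assoc, h, mul_smul_comm, mul_assoc, ← mul_assoc _ (x _),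
      ih, e, mul_smul, mul_smul, smul_mul_assoc, mul_smul_comm, smul_smul, hc, one_smul, mul_assoc,
      ← mul_assoc (t l), h]
    simp only [smul_mul_assoc, mul_assoc, mul_neg, smul_neg]

variable (ht : ∀ a b, SpinSymRel t a b → a = b)
include ht

theorem t_mul_self (l : Fin (n - 1)) : t l * t l = 1 := ht _ _ (.sq l)

theorem t_mul_t_mul (l : Fin (n - 1)) (a : A) : t l * (t l * a) = a := by
  rw [← mul_assoc, t_mul_self ht, one_mul]

/-- A generator `t_l` to the right of both `i` and `j` anticommutes with `[i, j]`. -/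
theorem t_mul_oddTransp_of_lt (l : Fin (n - 1)) (i j : Fin n) (hi' : i < lo l) (hj : j < lo l) :
    t l * oddTransp t i j = -(oddTransp t i j * t l) := by
  induction i, j using oddTransp_induction with
  | diag i => simp [oddTransp_self]
  | symm i j h => rw [oddTransp_swap, mul_neg, h hj hi', neg_mul]
  | base m =>
    rw [oddTransp_lo_hi]
    exact ht _ _ (.anticomm l m (.inr (by simpa [hi, lo, Fin.lt_def] using hj)))
  | step m i him ih =>
    have hm : t l * t m = -(t m * t l) :=
      ht _ _ (.anticomm l m (.inr (by simpa [hi, lo, Fin.lt_def] using hj)))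
    rw [oddTransp_hi _ _ _ him, mul_neg, ← mul_assoc, ← mul_assoc, hm, neg_mul, mul_assoc (t m),
      ih hi' ((lo_lt_hi m).trans hj)]
    simp only [mul_neg, neg_mul, neg_neg, mul_assoc, hm]

/-- Conjugation by `t_l` permutes the odd transpositions up to sign. The braid relation enters when
`l + 1` is the last index in the word for `[i, j]`. -/
theorem t_mul_oddTransp (l : Fin (n - 1)) (i j : Fin n) :
    t l * oddTransp t i j =
      -(oddTransp t (Equiv.swap (lo l) (hi l) i) (Equiv.swap (lo l) (hi l) j) * t l) := by
  induction i, j using oddTransp_induction generalizing l with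
  | diag i => simp [oddTransp_self]
  | symm i j h => rw [oddTransp_swap, mul_neg, h, oddTransp_swap t _ (Equiv.swap _ _ j), neg_mul]
  | base m =>
    rw [oddTransp_lo_hi]
    by_cases h1 : l = m
    · subst h1
      rw [Equiv.swap_apply_left, Equiv.swap_apply_right, oddTransp_swap, oddTransp_lo_hi]
      simp
    by_cases h2 : (l : ℕ) = m + 1
    · have e : hi m = lo l := Fin.ext (by simp [lo, hi, h2])
      have hlt : lo m < lo l := by simp only [lo, Fin.lt_def]; omega
      rw [e, Equiv.swap_apply_left, Equiv.swap_apply_of_ne_of_ne hlt.ne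
        (hlt.trans (lo_lt_hi l)).ne, oddTransp_hi _ _ _ hlt, ← e, oddTransp_lo_hi]
      simp only [neg_mul, neg_neg, mul_assoc, t_mul_self ht, mul_one]
    by_cases h3 : (l : ℕ) + 1 = m
    · have e : hi l = lo m := Fin.ext (by simp [lo, hi, h3])
      have hlt : lo l < lo m := by simp only [lo, Fin.lt_def]; omega
      rw [← e, Equiv.swap_apply_right, e, Equiv.swap_apply_of_ne_of_ne
        (hlt.trans (lo_lt_hi m)).ne' (lo_lt_hi m).ne', oddTransp_hi _ _ _ hlt, ← e, oddTransp_lo_hi,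
        neg_mul, neg_neg, ← ht _ _ (.braid l m h3), mul_assoc, t_mul_self ht, mul_one]
    · have hne : (l : ℕ) ≠ m := fun h => h1 (Fin.ext h)
      rw [Equiv.swap_apply_of_ne_of_ne, Equiv.swap_apply_of_ne_of_ne, oddTransp_lo_hi]
      · exact ht _ _ (.anticomm l m (by omega))
      all_goals simp only [lo, hi, ne_eq, Fin.mk.injEq]; omega
  | step m i him ih =>
    have him' : (i : ℕ) < m := by simpa [lo, Fin.lt_def] using him
    by_cases h1 : l = m
    · subst h1
      rw [Equiv.swap_apply_right, Equiv.swap_apply_of_ne_of_ne him.ne (him.trans (lo_lt_hi l)).ne,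
        oddTransp_hi _ _ _ him, mul_neg, mul_assoc, t_mul_t_mul ht]
    by_cases h2 : (l : ℕ) = m + 1
    · have e : hi m = lo l := Fin.ext (by simp [lo, hi, h2])
      have hlt : i < lo l := by simp only [lo, Fin.lt_def]; omega
      rw [e, Equiv.swap_apply_left, Equiv.swap_apply_of_ne_of_ne hlt.ne
        (hlt.trans (lo_lt_hi l)).ne, oddTransp_hi t l _ hlt]
      simp only [neg_mul, neg_neg, mul_assoc, t_mul_self ht, mul_one]
    by_cases h3 : (l : ℕ) + 1 = m
    -- Here `[i, m + 1]` is expanded twice and the outer generators are moved by the braid relation.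
    · have e : hi l = lo m := Fin.ext (by simp [lo, hi, h3])
      have hlt : lo l < lo m := by simp only [lo, Fin.lt_def]; omega
      rw [Equiv.swap_apply_of_ne_of_ne (x := hi m)
        (hlt.trans (lo_lt_hi m)).ne' (e ▸ (lo_lt_hi m).ne')]
      have hb := ht _ _ (.braid l m h3)
      by_cases h4 : i = lo l
      · subst h4
        rw [Equiv.swap_apply_left, e, oddTransp_lo_hi, oddTransp_hi _ _ _ hlt, ← e,
          oddTransp_lo_hi, mul_neg, ← mul_assoc, ← mul_assoc, hb, mul_assoc, t_mul_self ht, mul_one]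
      · have hil : i < lo l := by
          simp only [lo, Fin.lt_def]
          have : (i : ℕ) ≠ l := fun h => h4 (Fin.ext h)
          omega
        rw [Equiv.swap_apply_of_ne_of_ne hil.ne (hil.trans (lo_lt_hi l)).ne,
          oddTransp_hi _ _ _ him, ← e, oddTransp_hi _ _ _ hil]
        have ha := t_mul_oddTransp_of_lt ht m i (lo l) him hlt
        have hb' : ∀ a, t l * (t m * (t l * a)) = t m * (t l * (t m * a)) := fun a => by
          simp only [← mul_assoc, hb]
        have ha' : ∀ a, t m * (oddTransp t i (lo l) * a) = -(oddTransp t i (lo l) * (t m * a)) :=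
          fun a => by simp only [← mul_assoc, ha, neg_mul]
        simp only [mul_neg, neg_mul, neg_neg, mul_assoc] at hb ⊢
        rw [hb', ha', hb]
        simp only [mul_neg]
    · have hne : (l : ℕ) ≠ m := fun h => h1 (Fin.ext h)
      have hlm : t l * t m = -(t m * t l) := ht _ _ (.anticomm l m (by omega))
      have e1 : Equiv.swap (lo l) (hi l) (hi m) = hi m := Equiv.swap_apply_of_ne_of_ne
        (by simp only [lo, hi, ne_eq, Fin.mk.injEq]; omega)
        (by simp only [hi, ne_eq, Fin.mk.injEq]; omega)
      have e2 : Equiv.swap (lo l) (hi l) (lo m) = lo m := Equiv.swap_apply_of_ne_of_ne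
        (by simp only [lo, ne_eq, Fin.mk.injEq]; omega)
        (by simp only [lo, hi, ne_eq, Fin.mk.injEq]; omega)
      have hs : Equiv.swap (lo l) (hi l) i < lo m := by
        rw [Equiv.swap_apply_def]
        split_ifs <;> simp only [lo, hi, Fin.lt_def, Fin.ext_iff] at * <;> omega
      have ih' := ih l
      rw [e2] at ih'
      rw [e1, oddTransp_hi _ _ _ him, oddTransp_hi _ _ _ hs, mul_neg, ← mul_assoc, ← mul_assoc, hlm,
        neg_mul, mul_assoc (t m), ih']
      simp only [mul_neg, neg_mul, neg_neg, mul_assoc, hlm]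

theorem oddTransp_mul_oddTransp (i j k l : Fin n) :
    oddTransp t i j * oddTransp t k l =
      -(oddTransp t (Equiv.swap i j k) (Equiv.swap i j l) * oddTransp t i j) := by
  have := oddTransp_mul_eq_smul (t := t) (fun p : Fin n × Fin n => oddTransp t p.1 p.2) (-1)
    (by norm_num) (fun l m => by simpa using t_mul_oddTransp ht l m.1 m.2) i j (k, l)
  simpa using this

end OddTransp

/-! ### Odd Jucys–Murphy elements -/

section JucysMurphy

variable {n : ℕ} {A : Type*} [Ring A] (t : Fin (n - 1) → A)

/-- The odd Jucys–Murphy element `∑_{k < i} [k, i]` formed from elements `t_1, …, t_{n-1}` of a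
ring. -/
def oddJM (i : Fin n) : A := ∑ k ∈ Finset.univ.filter (fun k => k < i), oddTransp t k i

theorem map_oddJM {B F : Type*} [Ring B] [FunLike F A B] [RingHomClass F A B] (f : F)
    (i : Fin n) : f (oddJM t i) = oddJM (fun l => f (t l)) i := by
  simp [oddJM, map_oddTransp]

variable {t}

theorem oddJM_hi (l : Fin (n - 1)) : oddJM t (hi l) = t l - t l * oddJM t (lo l) * t l := by
  have e : Finset.univ.filter (fun k : Fin n => k < hi l) =
      insert (lo l) (Finset.univ.filter (fun k => k < lo l)) := by
    ext k
    simp only [Finset.mem_filter, Finset.mem_univ, true_and, Finset.mem_insert, lo, hi, Fin.lt_def,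
      Fin.ext_iff]
    omega
  rw [oddJM, e, Finset.sum_insert (by simp), oddTransp_lo_hi, oddJM, Finset.mul_sum,
    Finset.sum_mul, sub_eq_add_neg, ← Finset.sum_neg_distrib]
  congr 1
  exact Finset.sum_congr rfl fun k hk => oddTransp_hi _ _ _ (by simpa using hk)

theorem sum_lt_eq_sum_swap {M : Type*} [AddCommMonoid M] (f : Fin n → M) (i j k : Fin n)
    (h : i < k ↔ j < k) :
    ∑ l ∈ Finset.univ.filter (fun l => l < k), f (Equiv.swap i j l) =
      ∑ l ∈ Finset.univ.filter (fun l => l < k), f l := by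
  refine Finset.sum_equiv (Equiv.swap i j) (fun l => ?_) (fun _ _ => rfl)
  simp only [Finset.mem_filter, Finset.mem_univ, true_and, Equiv.swap_apply_def]
  split_ifs with h1 h2
  · rw [h1]; exact h
  · rw [h2]; exact h.symm
  · rfl

variable (ht : ∀ a b, SpinSymRel t a b → a = b)
include ht

/-- The set of summands `[l, k]`, `l < k`, of an odd Jucys–Murphy element is preserved by `s_{ij}`
if `i` and `j` lie on the same side of `k`. -/
theorem oddTransp_mul_oddJM (i j k : Fin n) (hi' : k ≠ i) (hj : k ≠ j) (h : i < k ↔ j < k) :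
    oddTransp t i j * oddJM t k = -(oddJM t k * oddTransp t i j) := by
  rw [oddJM, Finset.mul_sum, Finset.sum_mul, ← Finset.sum_neg_distrib,
    ← sum_lt_eq_sum_swap (fun l => -(oddTransp t l k * oddTransp t i j)) i j k h]
  exact Finset.sum_congr rfl fun l _ => by
    rw [oddTransp_mul_oddTransp ht, Equiv.swap_apply_of_ne_of_ne hi' hj]

theorem t_mul_oddJM (l : Fin (n - 1)) (i : Fin n) (h : i ≠ lo l) (h' : i ≠ hi l) :
    t l * oddJM t i = -(oddJM t i * t l) := by
  have := oddTransp_mul_oddJM ht (lo l) (hi l) i h h' (by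
    simp only [lo, hi, Fin.lt_def, ne_eq, Fin.ext_iff] at *; omega)
  rwa [oddTransp_lo_hi] at this

theorem oddJM_mul_oddJM (i j : Fin n) (h : i ≠ j) :
    oddJM t i * oddJM t j = -(oddJM t j * oddJM t i) := by
  wlog hij : i < j generalizing i j
  · rw [this j i h.symm (lt_of_le_of_ne (not_lt.mp hij) h.symm), neg_neg]
  rw [oddJM, Finset.sum_mul, Finset.mul_sum, ← Finset.sum_neg_distrib]
  refine Finset.sum_congr rfl fun k hk => ?_
  have hk : k < i := by simpa using hk
  exact oddTransp_mul_oddJM ht k i j (hk.trans hij).ne' hij.ne' (by simp [hij, hk.trans hij])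

end JucysMurphy

/-! ### Families of elements permuted by the generators `t_l` -/

section Permuted

variable {n : ℕ} {A : Type*} [Ring A] {t : Fin (n - 1) → A}
  (ht : ∀ a b, SpinSymRel t a b → a = b)
include ht

/-- The rule `t_l x_{l+1} = ± x_l t_l` follows from `t_l x_l = ± x_{l+1} t_l` by conjugation. -/
theorem t_mul_eq_smul (x : Fin n → A) (c : ℤ) (hc : c * c = 1)
    (h : ∀ l, t l * x (lo l) = c • (x (hi l) * t l))
    (h' : ∀ l m, m ≠ lo l → m ≠ hi l → t l * x m = c • (x m * t l)) (l : Fin (n - 1)) (m : Fin n) :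
    t l * x m = c • (x (Equiv.swap (lo l) (hi l) m) * t l) := by
  by_cases h1 : m = lo l
  · rw [h1, Equiv.swap_apply_left, h]
  by_cases h2 : m = hi l
  · rw [h2, Equiv.swap_apply_right]
    have h3 : x (hi l) = c • (t l * x (lo l) * t l) := by
      rw [h, smul_mul_assoc, smul_smul, hc, one_smul, mul_assoc, t_mul_self ht, mul_one]
    rw [h3, mul_smul_comm, mul_assoc, t_mul_t_mul ht]
  · rw [Equiv.swap_apply_of_ne_of_ne h1 h2, h' l m h1 h2]

/-- If the `x_m` are permuted up to sign by the `t_l`, then they anticommute as soon as the first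
two of them do. -/
theorem mul_eq_neg_mul_of_first (x : Fin n → A)
    (h : ∀ l m, t l * x m = -(x (Equiv.swap (lo l) (hi l) m) * t l))
    (h0 : ∀ l : Fin (n - 1), (l : ℕ) = 0 → x (lo l) * x (hi l) = -(x (hi l) * x (lo l)))
    (i j : Fin n) (hij : i ≠ j) : x i * x j = -(x j * x i) := by
  have conj : ∀ (l : Fin (n - 1)) (i j : Fin n), x i * x j = -(x j * x i) →
      ∀ i' j', Equiv.swap (lo l) (hi l) i = i' → Equiv.swap (lo l) (hi l) j = j' →
      x i' * x j' = -(x j' * x i') := by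
    rintro l i j hx _ _ rfl rfl
    set s := Equiv.swap (lo l) (hi l)
    have e : ∀ i j, t l * (x i * x j) = x (s i) * x (s j) * t l := fun i j => by
      rw [← mul_assoc, h, neg_mul, mul_assoc, h, mul_neg, neg_neg, mul_assoc]
    have h1 : x (s i) * x (s j) * t l = -(x (s j) * x (s i)) * t l := by
      rw [← e, hx, mul_neg, e, neg_mul]
    have h2 := congrArg (fun a => a * t l) h1
    simpa only [mul_assoc, t_mul_self ht, mul_one, neg_mul] using h2
  have base : ∀ (k : ℕ) (l : Fin (n - 1)), (l : ℕ) = k →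
      x (lo l) * x (hi l) = -(x (hi l) * x (lo l)) := by
    intro k
    induction k with
    | zero => exact h0
    | succ k ih =>
      intro l hl
      let m : Fin (n - 1) := ⟨k, by have := l.2; omega⟩
      have e : hi m = lo l := Fin.ext (by simp [hi, lo, m, hl])
      have h1 : lo m < lo l := by simp only [lo, Fin.lt_def, m]; omega
      have h2 := conj l _ _ (ih m rfl) (lo m) (hi l)
        (Equiv.swap_apply_of_ne_of_ne h1.ne (h1.trans (lo_lt_hi l)).ne)
        (by rw [e, Equiv.swap_apply_left])
      exact conj m _ _ h2 (lo l) (hi l) (by rw [Equiv.swap_apply_left, e])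
        (Equiv.swap_apply_of_ne_of_ne (h1.trans (lo_lt_hi l)).ne' (e ▸ (lo_lt_hi l).ne'))
  induction i, j using oddTransp_induction with
  | diag i => exact absurd rfl hij
  | symm i j ih => rw [ih hij.symm, neg_neg]
  | base l => exact base l l rfl
  | step l i him ih =>
    exact conj l i (lo l) (ih him.ne) _ _
      (Equiv.swap_apply_of_ne_of_ne him.ne (him.trans (lo_lt_hi l)).ne) (Equiv.swap_apply_left _ _)

omit ht in
theorem oddTransp_mul_of_even (x : Fin n → A)
    (h : ∀ l m, t l * x m = x (Equiv.swap (lo l) (hi l) m) * t l) (i j m : Fin n) :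
    oddTransp t i j * x m = x (Equiv.swap i j m) * oddTransp t i j := by
  simpa using oddTransp_mul_eq_smul x 1 (by norm_num) (fun l m => by simpa using h l m) i j m

omit ht in
theorem oddTransp_mul_of_odd (x : Fin n → A)
    (h : ∀ l m, t l * x m = -(x (Equiv.swap (lo l) (hi l) m) * t l)) (i j m : Fin n) :
    oddTransp t i j * x m = -(x (Equiv.swap i j m) * oddTransp t i j) := by
  simpa using oddTransp_mul_eq_smul x (-1) (by norm_num) (fun l m => by simpa using h l m) i j m

end Permuted

/-! ### Relations in the two algebras -/

theorem SpinSymRel.map_eq {n : ℕ} {A B : Type*} [Ring A] [Algebra ℂ A] [Ring B] [Algebra ℂ B]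
    (f : A →ₐ[ℂ] B) {t : Fin (n - 1) → A} (h : ∀ a b, SpinSymRel (fun i => f (t i)) a b → a = b)
    {a b : A} (hab : SpinSymRel t a b) : f a = f b := by
  cases hab with
  | sq i => simpa using h _ _ (.sq i)
  | braid i j hij => simpa using h _ _ (.braid i j hij)
  | anticomm i j hij => simpa using h _ _ (.anticomm i j hij)

namespace SpinSym

variable {n : ℕ}

theorem hom_ext {A : Type*} [Ring A] [Algebra ℂ A] {f g : SpinSym n →ₐ[ℂ] A}
    (h : ∀ l, f (t l) = g (t l)) : f = g := by
  refine RingQuot.ringQuot_ext' ℂ f g (FreeAlgebra.hom_ext ?_)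
  funext l
  exact h l

end SpinSym

namespace RatDaha

variable {n : ℕ} (u : ℂ)

theorem t_rel (a b : RatDaha n u) (h : SpinSymRel (t u) a b) : a = b :=
  SpinSymRel.map (mk n u) (fun _ _ h => mk_rel n u (.spin h)) a b h

theorem ofSpin_t (l : Fin (n - 1)) : ofSpin u (SpinSym.t l) = t u l := SpinSym.lift_t _ _ l

theorem mk_oddTransp (i j : Fin n) : mk n u (oddTransp ft i j) = oddTransp (t u) i j :=
  map_oddTransp _ _ i j

theorem hom_ext {A : Type*} [Ring A] [Algebra ℂ A] {f g : RatDaha n u →ₐ[ℂ] A}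
    (hx : ∀ i, f (xi u i) = g (xi u i)) (hy : ∀ i, f (y u i) = g (y u i))
    (ht : ∀ i, f (t u i) = g (t u i)) : f = g := by
  refine RingQuot.ringQuot_ext' ℂ f g (FreeAlgebra.hom_ext ?_)
  funext x
  cases x with
  | xi i => exact hx i
  | y i => exact hy i
  | t i => exact ht i

/-- The homomorphism from `RatDaha n u` given by elements satisfying its relations. -/
def lift {A : Type*} [Ring A] [Algebra ℂ A] (x y : Fin n → A) (t : Fin (n - 1) → A)
    (h : ∀ a b, SpinSymRel t a b → a = b)
    (xx : ∀ i j, i ≠ j → x i * x j = -(x j * x i))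
    (yy : ∀ i j, i ≠ j → y i * y j = y j * y i)
    (tx : ∀ l m, t l * x m = -(x (Equiv.swap (lo l) (hi l) m) * t l))
    (ty : ∀ l m, t l * y m = y (Equiv.swap (lo l) (hi l) m) * t l)
    (yx : ∀ i j, i ≠ j → y i * x j - x j * y i = u • oddTransp t i j)
    (yx' : ∀ i, y i * x i - x i * y i =
      u • ∑ k ∈ Finset.univ.filter (fun k => k ≠ i), oddTransp t i k) :
    RatDaha n u →ₐ[ℂ] A :=
  RingQuot.liftAlgHom ℂ ⟨FreeAlgebra.lift ℂ fun g => match g with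
    | .xi i => x i
    | .y i => y i
    | .t i => t i, by
    intro a b hab
    cases hab with
    | spin hs => exact SpinSymRel.map_eq _ (by simpa [ft] using h) hs
    | xi_xi i j hij => simpa [fxi] using xx i j hij
    | y_y i j hij => simpa [fy] using yy i j hij
    | t_xi i => simpa [fxi, ft] using tx i (lo i)
    | t_y i => simpa [fy, ft] using ty i (lo i)
    | t_xi' j i h1 h2 =>
      simpa [fxi, ft, Equiv.swap_apply_of_ne_of_ne h1 h2] using tx j i
    | t_y' j i h1 h2 =>
      simpa [fy, ft, Equiv.swap_apply_of_ne_of_ne h1 h2] using ty j i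
    | y_xi i j hij => simpa [fy, fxi, ft, map_oddTransp] using yx i j hij
    | y_xi_self i => simpa [fy, fxi, ft, map_oddTransp] using yx' i⟩


section Lift

variable {A : Type*} [Ring A] [Algebra ℂ A] {x y' : Fin n → A} {t' : Fin (n - 1) → A} {u}
  {h xx yy tx ty yx yx'}

theorem lift_xi (i : Fin n) : lift u x y' t' h xx yy tx ty yx yx' (xi u i) = x i := by
  unfold lift xi gen mk
  erw [RingQuot.liftAlgHom_mkAlgHom_apply]
  simp

theorem lift_y (i : Fin n) : lift u x y' t' h xx yy tx ty yx yx' (y u i) = y' i := by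
  unfold lift y gen mk
  erw [RingQuot.liftAlgHom_mkAlgHom_apply]
  simp

theorem lift_t (i : Fin (n - 1)) : lift u x y' t' h xx yy tx ty yx yx' (t u i) = t' i := by
  unfold lift t gen mk
  erw [RingQuot.liftAlgHom_mkAlgHom_apply]
  simp

end Lift

theorem mk_fxi (i : Fin n) : mk n u (fxi i) = xi u i := rfl

theorem mk_fy (i : Fin n) : mk n u (fy i) = y u i := rfl

theorem mk_ft (l : Fin (n - 1)) : mk n u (ft l) = t u l := rfl

theorem xi_mul_xi (i j : Fin n) (h : i ≠ j) : xi u i * xi u j = -(xi u j * xi u i) := by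
  simpa [mk_fxi] using mk_rel n u (.xi_xi i j h)

theorem y_xi (i j : Fin n) (h : i ≠ j) :
    y u i * xi u j - xi u j * y u i = u • oddTransp (t u) i j := by
  simpa [mk_fy, mk_fxi, mk_oddTransp] using mk_rel n u (.y_xi i j h)

theorem y_xi_self (i : Fin n) : y u i * xi u i - xi u i * y u i =
    u • ∑ k ∈ Finset.univ.filter (fun k => k ≠ i), oddTransp (t u) i k := by
  simpa [mk_fy, mk_fxi, mk_oddTransp] using mk_rel n u (.y_xi_self i)

theorem t_mul_xi (l : Fin (n - 1)) (m : Fin n) :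
    t u l * xi u m = -(xi u (Equiv.swap (lo l) (hi l) m) * t u l) := by
  simpa using t_mul_eq_smul (t_rel u) (xi u) (-1) (by norm_num)
    (fun l => by simpa [mk_ft, mk_fxi] using mk_rel n u (.t_xi l))
    (fun l m h h' => by simpa [mk_ft, mk_fxi] using mk_rel n u (.t_xi' l m h h')) l m

theorem t_mul_y (l : Fin (n - 1)) (m : Fin n) :
    t u l * y u m = y u (Equiv.swap (lo l) (hi l) m) * t u l := by
  simpa using t_mul_eq_smul (t_rel u) (y u) 1 (by norm_num)
    (fun l => by simpa [mk_ft, mk_fy] using mk_rel n u (.t_y l))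
    (fun l m h h' => by simpa [mk_ft, mk_fy] using mk_rel n u (.t_y' l m h h')) l m

end RatDaha

section LatticeWords

variable {n : ℕ}

/-- A product over `Fin n` in a possibly noncommutative monoid with a single factor different from
`1`. -/
theorem prod_ofFn_eq_single {M : Type*} [Monoid M] {n : ℕ} (f : Fin n → M) (i : Fin n)
    (h : ∀ j, j ≠ i → f j = 1) : (List.ofFn f).prod = f i := by
  induction n with
  | zero => exact i.elim0
  | succ n ih =>
    rw [List.ofFn_succ, List.prod_cons]
    cases i using Fin.cases with
    | zero =>
      rw [List.prod_eq_one, mul_one]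
      intro a ha
      obtain ⟨j, rfl⟩ := List.mem_ofFn.mp ha
      exact h _ (Fin.succ_ne_zero j)
    | succ i =>
      rw [h 0 (Fin.succ_ne_zero i).symm, one_mul]
      exact ih (fun j => f j.succ) i fun j hj => h _ fun e => hj (Fin.succ_injective _ e)

theorem gexp_single (i : Fin n) : gexp (Pi.single i 1) = ge i := by
  unfold gexp
  rw [prod_ofFn_eq_single _ i fun j hj => by simp [hj]]
  simp

theorem glat_lexp (η : Fin n → ℤ) : glat (lexp η) = gexp η := by
  simp [glat, lexp]

theorem glat_neg (q : LatticeAlg n) : glat (-q) = -glat q := by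
  simp [glat, Finsupp.sum]

theorem glat_zero : glat (0 : LatticeAlg n) = 0 := by
  simp [glat]

theorem IsDivDiff.neg {k i : Fin n} {η θ : Fin n → ℤ} {q : LatticeAlg n} (h : IsDivDiff k i η q)
    (hθ : lexp θ - lexp (swapAct k i θ) = -(lexp η - lexp (swapAct k i η))) :
    IsDivDiff k i θ (-q) := by
  unfold IsDivDiff at *
  rw [neg_mul, h, hθ]

theorem swapAct_single (k i j : Fin n) :
    swapAct k i (Pi.single j 1) = Pi.single (Equiv.swap k i j) 1 := by
  funext l
  simp [swapAct, Pi.single_apply, Equiv.swap_apply_eq_iff]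

/-- The quotient `(e^{ε_i} - e^{ε_k}) / (1 - e^{sgn(k-i)(ε_k - ε_i)})`. -/
noncomputable def divDiffSingle (k i : Fin n) : LatticeAlg n :=
  if i < k then lexp (Pi.single i 1) else -lexp (Pi.single k 1)

theorem isDivDiff_divDiffSingle (k i : Fin n) (h : k ≠ i) :
    IsDivDiff k i (Pi.single i 1) (divDiffSingle k i) := by
  unfold IsDivDiff divDiffSingle
  rw [swapAct_single, Equiv.swap_apply_right]
  split_ifs with hik
  · have : sgn k i = 1 := Int.sign_eq_one_of_pos (by rw [Fin.lt_def] at hik; omega)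
    rw [this, mul_sub, lexp_mul]
    simp
  · have : sgn k i = -1 := Int.sign_eq_neg_one_of_neg (by
      rw [Fin.lt_def] at hik; have : (k : ℕ) ≠ i := fun e => h (Fin.ext e); omega)
    rw [this, mul_sub, neg_mul, neg_mul, lexp_mul, add_comm]
    simp [sub_eq_add_neg, add_comm]

theorem isDivDiff_neg_divDiffSingle (k i : Fin n) (h : k ≠ i) :
    IsDivDiff k i (Pi.single k 1) (-divDiffSingle k i) :=
  (isDivDiff_divDiffSingle k i h).neg (by simp [swapAct_single])

theorem isDivDiff_zero (k i j : Fin n) (hk : j ≠ k) (hi' : j ≠ i) :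
    IsDivDiff k i (Pi.single j 1) 0 := by
  simp [IsDivDiff, swapAct_single, Equiv.swap_apply_of_ne_of_ne hk hi']

end LatticeWords

namespace TrigDaha

variable {n : ℕ} (u : ℂ)

theorem t_rel (a b : TrigDaha n u) (h : SpinSymRel (t u) a b) : a = b :=
  SpinSymRel.map (mk n u) (fun _ _ h => mk_rel n u (.spin h)) a b h

theorem ofSpin_t (l : Fin (n - 1)) : ofSpin u (SpinSym.t l) = t u l := SpinSym.lift_t _ _ l

theorem mk_oddTransp (i j : Fin n) : mk n u (oddTransp gt i j) = oddTransp (t u) i j :=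
  map_oddTransp _ _ i j

theorem ofSpin_jucysMurphy (i : Fin n) : ofSpin u (jucysMurphy i) = oddJM (t u) i := by
  refine (map_oddJM SpinSym.t (ofSpin u) i).trans ?_
  simp_rw [ofSpin_t]

theorem mk_ge (i : Fin n) : mk n u (ge i) = e u i := rfl

theorem mk_geInv (i : Fin n) : mk n u (geInv i) = eInv u i := rfl

theorem mk_gzeta (i : Fin n) : mk n u (gzeta i) = zeta u i := rfl

theorem mk_gt (l : Fin (n - 1)) : mk n u (gt l) = t u l := rfl

theorem e_mul_eInv (i : Fin n) : e u i * eInv u i = 1 := by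
  simpa [mk_ge, mk_geInv] using mk_rel n u (.e_eInv i)

theorem eInv_mul_e (i : Fin n) : eInv u i * e u i = 1 := by
  simpa [mk_ge, mk_geInv] using mk_rel n u (.eInv_e i)

theorem e_mul_e (i j : Fin n) : e u i * e u j = e u j * e u i := by
  simpa [mk_ge] using mk_rel n u (.e_e i j)

theorem t_mul_e (l : Fin (n - 1)) (m : Fin n) :
    t u l * e u m = e u (Equiv.swap (lo l) (hi l) m) * t u l := by
  simpa using t_mul_eq_smul (t_rel u) (e u) 1 (by norm_num)
    (fun l => by simpa [mk_gt, mk_ge] using mk_rel n u (.t_e l))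
    (fun l m h h' => by simpa [mk_gt, mk_ge] using mk_rel n u (.t_e' l m h h')) l m

theorem zeta_t (l : Fin (n - 1)) :
    zeta u (hi l) * t u l + t u l * zeta u (lo l) = algebraMap ℂ _ u := by
  simpa [mk_gt, mk_gzeta] using mk_rel n u (.zeta_t l)

theorem zeta_t' (l : Fin (n - 1)) (j : Fin n) (h : j ≠ lo l) (h' : j ≠ hi l) :
    zeta u j * t u l = -(t u l * zeta u j) := by
  simpa [mk_gt, mk_gzeta] using mk_rel n u (.zeta_t' l j h h')

theorem zeta_zeta (i j : Fin n) (h : i ≠ j) : zeta u i * zeta u j = -(zeta u j * zeta u i) := by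
  simpa [mk_gzeta] using mk_rel n u (.zeta_zeta i j h)

theorem sgn_smul_mk_glat (k i : Fin n) (h : k ≠ i) (a : TrigDaha n u) :
    (sgn k i : ℂ) • (mk n u (glat (divDiffSingle k i)) * a) =
      (if i < k then e u i else e u k) * a := by
  unfold divDiffSingle
  split_ifs with hik
  · have : sgn k i = 1 := Int.sign_eq_one_of_pos (by rw [Fin.lt_def] at hik; omega)
    rw [this, glat_lexp, gexp_single]
    simp [mk_ge]
  · have : sgn k i = -1 := Int.sign_eq_neg_one_of_neg (by
      rw [Fin.lt_def] at hik; have : (k : ℕ) ≠ i := fun e => h (Fin.ext e); omega)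
    rw [this, glat_neg, glat_lexp, gexp_single]
    simp [mk_ge]

/-- The relation between `ζ_i` and `e^η` for `η = ε_j`, `j ≠ i`: only the term `k = j` survives. -/
theorem zeta_e (i j : Fin n) (h : j ≠ i) : zeta u i * e u j - e u j * zeta u i =
    -(u • ((if i < j then e u i else e u j) * oddTransp (t u) j i)) := by
  have := mk_rel n u (.zeta_exp i (Pi.single j 1)
    (fun k => if k = j then -divDiffSingle j i else 0) (fun k hk => by
      split_ifs with hkj
      · subst hkj; exact isDivDiff_neg_divDiffSingle k i hk
      · exact isDivDiff_zero k i j (Ne.symm hkj) h))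
  rw [gexp_single, map_sub, map_mul, map_mul, mk_ge, mk_gzeta, map_smul, map_sum,
    Finset.sum_eq_single j] at this
  · rw [this, if_pos rfl, map_smul, map_mul, glat_neg, map_neg, neg_mul, smul_neg,
      sgn_smul_mk_glat u j i h, mk_oddTransp, smul_neg]
  · intro k _ hkj
    simp [hkj, glat_zero]
  · intro hj
    simp [h] at hj

/-- The relation between `ζ_i` and `e^η` for `η = ε_i`. -/
theorem zeta_e_self (i : Fin n) : zeta u i * e u i - e u i * zeta u i =
    u • ∑ k ∈ Finset.univ.filter (fun k => k ≠ i),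
      (if i < k then e u i else e u k) * oddTransp (t u) k i := by
  have := mk_rel n u (.zeta_exp i (Pi.single i 1)
    (fun k => divDiffSingle k i) (fun k hk => isDivDiff_divDiffSingle k i hk))
  rw [gexp_single, map_sub, map_mul, map_mul, mk_ge, mk_gzeta, map_smul, map_sum] at this
  rw [this]
  congr 1
  refine Finset.sum_congr rfl fun k hk => ?_
  rw [map_smul, map_mul, sgn_smul_mk_glat u k i (by simpa using hk), mk_oddTransp]

end TrigDaha

/-! ### Construction of the homomorphism `ι` -/

namespace TrigDaha

variable {n : ℕ} (u : ℂ)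

theorem e_mul_eInv_comm (i j : Fin n) : e u i * eInv u j = eInv u j * e u i := by
  calc e u i * eInv u j = eInv u j * (e u j * e u i) * eInv u j := by
        rw [← mul_assoc, eInv_mul_e, one_mul]
    _ = eInv u j * e u i := by rw [e_mul_e, mul_assoc, mul_assoc, e_mul_eInv, mul_one]

theorem eInv_mul_eInv (i j : Fin n) : eInv u i * eInv u j = eInv u j * eInv u i := by
  calc eInv u i * eInv u j = eInv u j * (e u j * eInv u i) * eInv u j := by
        rw [← mul_assoc, eInv_mul_e, one_mul]
    _ = eInv u j * eInv u i := by rw [e_mul_eInv_comm, mul_assoc, mul_assoc, e_mul_eInv, mul_one]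

theorem t_mul_eInv (l : Fin (n - 1)) (m : Fin n) :
    t u l * eInv u m = eInv u (Equiv.swap (lo l) (hi l) m) * t u l := by
  set s := Equiv.swap (lo l) (hi l)
  calc t u l * eInv u m = eInv u (s m) * (e u (s m) * t u l) * eInv u m := by
        rw [← mul_assoc, eInv_mul_e, one_mul]
    _ = eInv u (s m) * t u l := by rw [← t_mul_e, mul_assoc, mul_assoc, e_mul_eInv, mul_one]

/-- The element `ζ_i - u ∑_{k < i} [k, i] = e^{ε_i} ι(ξ_i)`. -/
def zetaSub (i : Fin n) : TrigDaha n u := zeta u i - u • oddJM (t u) i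

theorem e_oddTransp (i j k : Fin n) : oddTransp (t u) i j * e u k =
    e u (Equiv.swap i j k) * oddTransp (t u) i j :=
  oddTransp_mul_of_even _ (t_mul_e u) i j k

theorem oddTransp_eInv (i j k : Fin n) : oddTransp (t u) i j * eInv u k =
    eInv u (Equiv.swap i j k) * oddTransp (t u) i j :=
  oddTransp_mul_of_even _ (t_mul_eInv u) i j k

theorem e_oddJM (i j : Fin n) : e u j * oddJM (t u) i - oddJM (t u) i * e u j =
    ∑ k ∈ Finset.univ.filter (fun k => k < i),
      (e u j - e u (Equiv.swap k i j)) * oddTransp (t u) k i := by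
  rw [oddJM, Finset.mul_sum, Finset.sum_mul, ← Finset.sum_sub_distrib]
  exact Finset.sum_congr rfl fun k _ => by rw [e_oddTransp, sub_mul]

theorem e_zetaSub (i j : Fin n) (h : j ≠ i) : e u j * zetaSub u i - zetaSub u i * e u j =
    u • (e u i * oddTransp (t u) j i) := by
  have h1 : e u j * zetaSub u i - zetaSub u i * e u j =
      -(zeta u i * e u j - e u j * zeta u i) -
        u • (e u j * oddJM (t u) i - oddJM (t u) i * e u j) := by
    simp only [zetaSub, mul_sub, sub_mul, mul_smul_comm, smul_mul_assoc, smul_sub]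
    abel
  have h2 : e u j * oddJM (t u) i - oddJM (t u) i * e u j =
      if j < i then (e u j - e u i) * oddTransp (t u) j i else 0 := by
    have h3 : ∀ k, k ≠ j → (e u j - e u (Equiv.swap k i j)) * oddTransp (t u) k i = 0 :=
      fun k hk => by rw [Equiv.swap_apply_of_ne_of_ne hk.symm h, sub_self, zero_mul]
    rw [e_oddJM]
    split_ifs with hji
    · rw [Finset.sum_eq_single j (fun k _ hk => h3 k hk) (fun hj => by simp [hji] at hj),
        Equiv.swap_apply_left]
    · exact Finset.sum_eq_zero fun k hk => h3 k fun e => hji (by simpa [e] using hk)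
  rw [h1, h2, zeta_e u i j h, neg_neg]
  by_cases hji : j < i
  · rw [if_pos hji, if_neg hji.not_gt, ← smul_sub, ← sub_mul, sub_sub_cancel]
  · rw [if_neg hji, if_pos (lt_of_le_of_ne (not_lt.mp hji) h.symm), smul_zero, sub_zero]

theorem e_zetaSub_self (i : Fin n) : e u i * zetaSub u i - zetaSub u i * e u i =
    u • ∑ k ∈ Finset.univ.filter (fun k => k ≠ i), e u i * oddTransp (t u) i k := by
  have h1 : e u i * zetaSub u i - zetaSub u i * e u i =
      -(zeta u i * e u i - e u i * zeta u i) -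
        u • (e u i * oddJM (t u) i - oddJM (t u) i * e u i) := by
    simp only [zetaSub, mul_sub, sub_mul, mul_smul_comm, smul_mul_assoc, smul_sub]
    abel
  have h2 : e u i * oddJM (t u) i - oddJM (t u) i * e u i =
      ∑ k ∈ Finset.univ.filter (fun k => k ≠ i),
        if k < i then (e u i - e u k) * oddTransp (t u) k i else 0 := by
    rw [e_oddJM, ← Finset.sum_filter, Finset.filter_filter]
    refine Finset.sum_congr ?_ fun k _ => by rw [Equiv.swap_apply_right]
    ext k
    simpa using fun h => ne_of_lt h
  rw [h1, h2, zeta_e_self, ← smul_neg, ← smul_sub, ← Finset.sum_neg_distrib,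
    ← Finset.sum_sub_distrib]
  congr 1
  refine Finset.sum_congr rfl fun k hk => ?_
  have hk : k ≠ i := by simpa using hk
  rw [oddTransp_swap _ k i]
  by_cases hki : k < i
  · rw [if_pos hki, if_neg hki.not_gt, sub_mul, mul_neg]
    abel
  · rw [if_neg hki, if_pos (lt_of_le_of_ne (not_lt.mp hki) hk.symm)]
    simp

theorem zetaSub_mul_eInv (i j : Fin n) (h : j ≠ i) : zetaSub u i * eInv u j =
    eInv u j * (zetaSub u i + u • oddTransp (t u) j i) := by
  have h1 : e u j * zetaSub u i = zetaSub u i * e u j + u • (e u i * oddTransp (t u) j i) := by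
    rw [← e_zetaSub u i j h]; abel
  calc zetaSub u i * eInv u j = eInv u j * (e u j * zetaSub u i) * eInv u j := by
        rw [← mul_assoc, eInv_mul_e, one_mul]
    _ = eInv u j * (zetaSub u i * (e u j * eInv u j) +
          u • (e u i * (oddTransp (t u) j i * eInv u j))) := by
        rw [h1]; simp only [mul_assoc, add_mul, smul_mul_assoc, mul_add, mul_smul_comm]
    _ = _ := by
        rw [e_mul_eInv, mul_one, oddTransp_eInv, Equiv.swap_apply_left, ← mul_assoc (e u i),
          e_mul_eInv, one_mul]

/-- The image `e^{-ε_i} (ζ_i - u ∑_{k < i} [k, i])` of `ξ_i` under `ι`. -/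
def xi (i : Fin n) : TrigDaha n u := eInv u i * zetaSub u i

theorem t_mul_zetaSub_lo (l : Fin (n - 1)) :
    t u l * zetaSub u (lo l) = -(zetaSub u (hi l) * t u l) := by
  have h := zeta_t u l
  rw [Algebra.algebraMap_eq_smul_one] at h
  have h1 : t u l * zeta u (lo l) = u • 1 - zeta u (hi l) * t u l := eq_sub_of_add_eq' h
  rw [zetaSub, zetaSub, oddJM_hi]
  simp only [mul_sub, sub_mul, mul_smul_comm, smul_mul_assoc, h1, mul_assoc, t_mul_self (t_rel u),
    smul_sub, mul_one]
  abel

theorem t_mul_zetaSub' (l : Fin (n - 1)) (m : Fin n) (h : m ≠ lo l) (h' : m ≠ hi l) :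
    t u l * zetaSub u m = -(zetaSub u m * t u l) := by
  rw [zetaSub, mul_sub, mul_smul_comm, t_mul_oddJM (t_rel u) l m h h', sub_mul, zeta_t' u l m h h',
    smul_neg, smul_mul_assoc]
  abel

theorem t_mul_xi (l : Fin (n - 1)) (m : Fin n) :
    t u l * xi u m = -(xi u (Equiv.swap (lo l) (hi l) m) * t u l) := by
  have h : t u l * zetaSub u m = -(zetaSub u (Equiv.swap (lo l) (hi l) m) * t u l) := by
    simpa using t_mul_eq_smul (t_rel u) (zetaSub u) (-1) (by norm_num)
      (fun l => by simpa using t_mul_zetaSub_lo u l)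
      (fun l m h h' => by simpa using t_mul_zetaSub' u l m h h') l m
  rw [xi, ← mul_assoc, t_mul_eInv, mul_assoc, h, mul_neg, xi, mul_assoc]

theorem xi_mul_xi (i j : Fin n) (h : i ≠ j) : xi u i * xi u j = -(xi u j * xi u i) := by
  refine mul_eq_neg_mul_of_first (t_rel u) (xi u) (t_mul_xi u) (fun l hl => ?_) i j h
  -- For the first two indices the odd Jucys–Murphy elements are `0` and `t_l`.
  have h0 : oddJM (t u) (lo l) = 0 := Finset.sum_eq_zero fun k hk => by
    simp [lo, Fin.lt_def, hl] at hk
  have ha : zetaSub u (lo l) = zeta u (lo l) := by rw [zetaSub, h0, smul_zero, sub_zero]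
  have hb : zetaSub u (hi l) = zeta u (hi l) - u • t u l := by
    rw [zetaSub, oddJM_hi, h0, mul_zero, zero_mul, sub_zero]
  have e : ∀ i j : Fin n, j ≠ i → xi u i * xi u j =
      eInv u i * eInv u j * ((zetaSub u i + u • oddTransp (t u) j i) * zetaSub u j) :=
    fun i j h => by
      rw [xi, xi, mul_assoc, ← mul_assoc (zetaSub u i), zetaSub_mul_eInv u i j h]
      simp only [mul_assoc]
  have ht : t u l * zeta u (hi l) = u • 1 - zeta u (lo l) * t u l := by
    have h := congrArg (fun a => t u l * a * t u l) (zeta_t u l)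
    simp only [mul_add, add_mul, mul_assoc, t_mul_self (t_rel u), t_mul_t_mul (t_rel u), mul_one,
      Algebra.algebraMap_eq_smul_one, smul_mul_assoc, mul_smul_comm] at h
    exact eq_sub_of_add_eq h
  rw [e _ _ (lo_ne_hi l).symm, e _ _ (lo_ne_hi l), eInv_mul_eInv u (lo l), ← mul_neg,
    oddTransp_swap, oddTransp_lo_hi, ha, hb, sub_add_cancel]
  congr 1
  simp only [smul_neg, add_mul, mul_sub, neg_mul, smul_mul_assoc, mul_smul_comm, ht,
    t_mul_self (t_rel u), zeta_zeta u _ _ (lo_ne_hi l), smul_sub,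
    smul_add, smul_neg]
  abel

theorem e_xi (i j : Fin n) :
    e u i * xi u j - xi u j * e u i = eInv u j * (e u i * zetaSub u j - zetaSub u j * e u i) := by
  rw [xi, ← mul_assoc, e_mul_eInv_comm, mul_sub, mul_assoc, mul_assoc]

end TrigDaha

/-- The homomorphism `ι`. -/
def iota (n : ℕ) (u : ℂ) : RatDaha n u →ₐ[ℂ] TrigDaha n u :=
  RatDaha.lift u (TrigDaha.xi u) (TrigDaha.e u) (TrigDaha.t u) (TrigDaha.t_rel u)
    (TrigDaha.xi_mul_xi u) (fun i j _ => TrigDaha.e_mul_e u i j) (TrigDaha.t_mul_xi u)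
    (TrigDaha.t_mul_e u)
    (fun i j h => by
      rw [TrigDaha.e_xi, TrigDaha.e_zetaSub u j i h, mul_smul_comm, ← mul_assoc,
        TrigDaha.eInv_mul_e, one_mul])
    (fun i => by
      rw [TrigDaha.e_xi, TrigDaha.e_zetaSub_self, mul_smul_comm, ← Finset.mul_sum, ← mul_assoc,
        TrigDaha.eInv_mul_e, one_mul])

section iota

variable {n : ℕ} (u : ℂ)

theorem iota_xi (i : Fin n) : iota n u (RatDaha.xi u i) = TrigDaha.xi u i := RatDaha.lift_xi i

theorem iota_y (i : Fin n) : iota n u (RatDaha.y u i) = TrigDaha.e u i := RatDaha.lift_y i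

theorem iota_t (i : Fin (n - 1)) : iota n u (RatDaha.t u i) = TrigDaha.t u i := RatDaha.lift_t i

theorem iota_ofSpin (s : SpinSym n) :
    iota n u (RatDaha.ofSpin u s) = TrigDaha.ofSpin u s := by
  have : (iota n u).comp (RatDaha.ofSpin u) = TrigDaha.ofSpin u := SpinSym.hom_ext fun l => by
    rw [AlgHom.comp_apply, RatDaha.ofSpin_t, iota_t, TrigDaha.ofSpin_t]
  exact DFunLike.congr_fun this s

end iota

section Parity

variable {A X : Type*} [Ring A] [Algebra ℂ A] {g : X → A} {p : X → ZMod 2}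

theorem gen_mem_parityPart (x : X) : g x ∈ parityPart g p (p x) :=
  Submodule.subset_span ⟨[x], by simp, by simp⟩

theorem one_mem_parityPart : (1 : A) ∈ parityPart g p 0 :=
  Submodule.subset_span ⟨[], by simp, by simp⟩

theorem mul_mem_parityPart {a b : A} {c d : ZMod 2} (ha : a ∈ parityPart g p c)
    (hb : b ∈ parityPart g p d) : a * b ∈ parityPart g p (c + d) := by
  have h := Submodule.mul_mem_mul ha hb
  unfold parityPart at h
  rw [Submodule.span_mul_span] at h
  refine Submodule.span_mono ?_ h
  rintro _ ⟨_, ⟨v, hv, rfl⟩, _, ⟨w, hw, rfl⟩, rfl⟩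
  exact ⟨v ++ w, by simp [hv, hw], by simp⟩

theorem oddTransp_mem_parityPart {n : ℕ} {t : Fin (n - 1) → A}
    (ht : ∀ l, t l ∈ parityPart g p 1) (i j : Fin n) : oddTransp t i j ∈ parityPart g p 1 := by
  induction i, j using oddTransp_induction with
  | diag i => rw [oddTransp_self]; exact zero_mem _
  | symm i j h => rw [oddTransp_swap]; exact neg_mem h
  | base l => rw [oddTransp_lo_hi]; exact ht l
  | step l i hi ih =>
    rw [oddTransp_hi _ _ _ hi]
    have h : t l * oddTransp t i (lo l) * t l ∈ parityPart g p (1 + 1 + 1) :=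
      mul_mem_parityPart (mul_mem_parityPart (ht l) ih) (ht l)
    exact Submodule.neg_mem _ h

end Parity

namespace TrigDaha

variable {n : ℕ} (u : ℂ)

theorem gen_mem_part (x : TrigGen n) : gen u x ∈ part u x.parity := gen_mem_parityPart x

theorem t_mem_part (l : Fin (n - 1)) : t u l ∈ part u 1 := gen_mem_part u (.t l)

theorem xi_mem_part (i : Fin n) : xi u i ∈ part u 1 := by
  have h1 : eInv u i ∈ part u 0 := gen_mem_part u (.eInv i)
  have h2 : zeta u i ∈ part u 1 := gen_mem_part u (.zeta i)
  have h3 : oddJM (t u) i ∈ part u 1 :=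
    Submodule.sum_mem _ fun k _ => oddTransp_mem_parityPart (t_mem_part u) k i
  have h4 : zetaSub u i ∈ part u 1 := Submodule.sub_mem _ h2 (Submodule.smul_mem _ u h3)
  have h5 := mul_mem_parityPart h1 h4
  rwa [zero_add] at h5

end TrigDaha

theorem iota_gen_mem_part {n : ℕ} (u : ℂ) (x : RatGen n) :
    iota n u (RatDaha.gen u x) ∈ TrigDaha.part u x.parity := by
  cases x with
  | xi i => exact (iota_xi u i).symm ▸ TrigDaha.xi_mem_part u i
  | y i => exact (iota_y u i).symm ▸ TrigDaha.gen_mem_part u (.e i)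
  | t l => exact (iota_t u l).symm ▸ TrigDaha.t_mem_part u l

theorem isIota_iota (n : ℕ) (u : ℂ) : IsIota (iota n u) where
  map_part d := by
    rw [RatDaha.part, parityPart, Submodule.map_span, Submodule.span_le]
    rintro _ ⟨_, ⟨w, rfl, rfl⟩, rfl⟩
    change iota n u _ ∈ TrigDaha.part u _
    induction w with
    | nil =>
      rw [List.map_nil, List.map_nil, List.prod_nil, List.sum_nil, map_one]
      exact one_mem_parityPart
    | cons x w ih =>
      simp only [List.map_cons, List.prod_cons, List.sum_cons, map_mul]
      exact mul_mem_parityPart (iota_gen_mem_part u x) ih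
  map_spin := iota_ofSpin u
  map_y := iota_y u
  map_xi i := by rw [iota_xi, TrigDaha.ofSpin_jucysMurphy]; rfl

theorem IsIota.eq_iota {n : ℕ} {u : ℂ} {f : RatDaha n u →ₐ[ℂ] TrigDaha n u} (hf : IsIota f) :
    f = iota n u := by
  refine RatDaha.hom_ext u (fun i => ?_) (fun i => ?_) (fun i => ?_)
  · rw [hf.map_xi, (isIota_iota n u).map_xi]
  · rw [hf.map_y, (isIota_iota n u).map_y]
  · rw [← RatDaha.ofSpin_t, hf.map_spin, iota_ofSpin]

/-! ### The algebra generated by the `ξ_i` and `t_i` -/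

/-- The defining relations between the generators `ξ_i` (`.inl i`) and `t_l` (`.inr l`) of
`RatDaha n u` that do not involve the `y_i`. -/
inductive OddRel (n : ℕ) :
    FreeAlgebra ℂ (Fin n ⊕ Fin (n - 1)) → FreeAlgebra ℂ (Fin n ⊕ Fin (n - 1)) → Prop
  | spin {a b} (h : SpinSymRel (fun l => FreeAlgebra.ι ℂ (.inr l)) a b) : OddRel n a b
  | xi_xi (i j : Fin n) (h : i ≠ j) : OddRel n (FreeAlgebra.ι ℂ (.inl i) * FreeAlgebra.ι ℂ (.inl j))
      (-(FreeAlgebra.ι ℂ (.inl j) * FreeAlgebra.ι ℂ (.inl i)))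
  | t_xi (l : Fin (n - 1)) (m : Fin n) :
      OddRel n (FreeAlgebra.ι ℂ (.inr l) * FreeAlgebra.ι ℂ (.inl m))
        (-(FreeAlgebra.ι ℂ (.inl (Equiv.swap (lo l) (hi l) m)) * FreeAlgebra.ι ℂ (.inr l)))

/-- The algebra presented by the generators `ξ_i` and `t_l` of `RatDaha n u` and their relations
among themselves. -/
def OddAlg (n : ℕ) : Type := RingQuot (OddRel n)

noncomputable instance (n : ℕ) : Ring (OddAlg n) := inferInstanceAs (Ring (RingQuot _))

noncomputable instance (n : ℕ) : Algebra ℂ (OddAlg n) := inferInstanceAs (Algebra ℂ (RingQuot _))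

namespace OddAlg

variable {n : ℕ}

/-- The generator `ξ_i`. -/
def xi (i : Fin n) : OddAlg n := RingQuot.mkAlgHom ℂ (OddRel n) (FreeAlgebra.ι ℂ (.inl i))

/-- The generator `t_l`. -/
def t (l : Fin (n - 1)) : OddAlg n := RingQuot.mkAlgHom ℂ (OddRel n) (FreeAlgebra.ι ℂ (.inr l))

theorem t_rel (a b : OddAlg n) (h : SpinSymRel t a b) : a = b :=
  SpinSymRel.map (RingQuot.mkAlgHom ℂ (OddRel n))
    (fun _ _ h => RingQuot.mkAlgHom_rel ℂ (.spin h)) a b h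

theorem xi_mul_xi (i j : Fin n) (h : i ≠ j) : xi i * xi j = -(xi j * xi i) := by
  have := RingQuot.mkAlgHom_rel ℂ (OddRel.xi_xi i j h)
  rwa [map_neg, map_mul, map_mul] at this

theorem t_mul_xi (l : Fin (n - 1)) (m : Fin n) :
    t l * xi m = -(xi (Equiv.swap (lo l) (hi l) m) * t l) := by
  have := RingQuot.mkAlgHom_rel ℂ (OddRel.t_xi l m)
  rwa [map_neg, map_mul, map_mul] at this

/-- The homomorphism from `OddAlg n` given by elements satisfying its relations. -/
noncomputable def lift {A : Type*} [Ring A] [Algebra ℂ A] (x : Fin n → A) (t : Fin (n - 1) → A)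
    (h : ∀ a b, SpinSymRel t a b → a = b)
    (xx : ∀ i j, i ≠ j → x i * x j = -(x j * x i))
    (tx : ∀ l m, t l * x m = -(x (Equiv.swap (lo l) (hi l) m) * t l)) : OddAlg n →ₐ[ℂ] A :=
  RingQuot.liftAlgHom ℂ ⟨FreeAlgebra.lift ℂ (Sum.elim x t), by
    intro a b hab
    cases hab with
    | spin hs => exact SpinSymRel.map_eq _ (by simpa using h) hs
    | xi_xi i j hij => simpa using xx i j hij
    | t_xi l m => simpa using tx l m⟩

section Lift

variable {A : Type*} [Ring A] [Algebra ℂ A] {x : Fin n → A} {t' : Fin (n - 1) → A} {h xx tx}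

theorem lift_xi (i : Fin n) : lift x t' h xx tx (xi i) = x i := by
  unfold lift xi
  erw [RingQuot.liftAlgHom_mkAlgHom_apply]
  simp

theorem lift_t (l : Fin (n - 1)) : lift x t' h xx tx (t l) = t' l := by
  unfold lift t
  erw [RingQuot.liftAlgHom_mkAlgHom_apply]
  simp

end Lift

theorem induction {P : OddAlg n → Prop} (hC : ∀ c : ℂ, P (algebraMap ℂ _ c)) (hx : ∀ i, P (xi i))
    (ht : ∀ l, P (t l)) (hadd : ∀ a b, P a → P b → P (a + b))
    (hmul : ∀ a b, P a → P b → P (a * b)) (a : OddAlg n) : P a := by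
  obtain ⟨w, rfl⟩ := RingQuot.mkAlgHom_surjective ℂ (OddRel n) a
  induction w using FreeAlgebra.induction with
  | grade0 c => rw [AlgHom.commutes]; exact hC c
  | grade1 g =>
    cases g with
    | inl i => exact hx i
    | inr l => exact ht l
  | mul a b ha hb => rw [map_mul]; exact hmul _ _ ha hb
  | add a b ha hb => rw [map_add]; exact hadd _ _ ha hb

end OddAlg

/-! ### Rational functions -/

/-- The field `ℂ(y_1, …, y_n)`. -/
abbrev RatFun (n : ℕ) : Type := FractionRing (MvPolynomial (Fin n) ℂ)

namespace RatFun

variable {n : ℕ}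

/-- The coordinate function `y_i`. -/
noncomputable def y (i : Fin n) : RatFun n := algebraMap (MvPolynomial (Fin n) ℂ) _ (.X i)

/-- The permutation `y_i ↦ y_{σ i}` of the coordinates. -/
noncomputable def perm (σ : Equiv.Perm (Fin n)) : RatFun n ≃ₐ[ℂ] RatFun n :=
  IsFractionRing.fieldEquivOfAlgEquiv ℂ (RatFun n) (RatFun n) (MvPolynomial.renameEquiv ℂ σ)

theorem perm_algebraMap (σ : Equiv.Perm (Fin n)) (p : MvPolynomial (Fin n) ℂ) :
    perm σ (algebraMap _ _ p) = algebraMap _ _ (MvPolynomial.rename σ p) :=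
  IsFractionRing.fieldEquivOfAlgEquiv_algebraMap _ _ _ _ _

theorem perm_y (σ : Equiv.Perm (Fin n)) (i : Fin n) : perm σ (y i) = y (σ i) := by
  rw [y, perm_algebraMap, MvPolynomial.rename_X, y]

theorem perm_mul (σ τ : Equiv.Perm (Fin n)) (f : RatFun n) :
    perm (σ * τ) f = perm σ (perm τ f) := by
  obtain ⟨p, q, -, rfl⟩ := IsFractionRing.div_surjective (MvPolynomial (Fin n) ℂ) f
  simp [perm_algebraMap, MvPolynomial.rename_rename]

theorem perm_one (f : RatFun n) : perm 1 f = f := by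
  obtain ⟨p, q, -, rfl⟩ := IsFractionRing.div_surjective (MvPolynomial (Fin n) ℂ) f
  simp [perm_algebraMap]

theorem y_injective : Function.Injective (y (n := n)) := fun i j h => by
  simpa using IsFractionRing.injective (MvPolynomial (Fin n) ℂ) (RatFun n) h

theorem y_ne_zero (i : Fin n) : y i ≠ 0 := by
  simp [y]

end RatFun

/-! ### Operators on `ℂ(y) ⊗ OddAlg` -/

/-- The space `ℂ(y) ⊗ OddAlg n` of the faithful representation of `RatDaha n u`. -/
abbrev RepSpace (n : ℕ) : Type := RatFun n ⊗[ℂ] OddAlg n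

/-- The algebra of `ℂ`-linear operators on `RepSpace n`, kept as a type of its own so that only its
ring structure is visible. It acts on `RepSpace n` by `•`. -/
def RepEnd (n : ℕ) : Type := Module.End ℂ (RepSpace n)

namespace RepEnd

variable {n : ℕ}

noncomputable instance : Ring (RepEnd n) := inferInstanceAs (Ring (Module.End ℂ (RepSpace n)))

noncomputable instance : Algebra ℂ (RepEnd n) :=
  inferInstanceAs (Algebra ℂ (Module.End ℂ (RepSpace n)))

noncomputable instance : Module (RepEnd n) (RepSpace n) :=
  inferInstanceAs (Module (Module.End ℂ (RepSpace n)) (RepSpace n))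

instance : IsScalarTower ℂ (RepEnd n) (RepSpace n) :=
  inferInstanceAs (IsScalarTower ℂ (Module.End ℂ (RepSpace n)) (RepSpace n))

theorem ext {B C : RepEnd n} (h : ∀ (f : RatFun n) (a : OddAlg n),
    B • (f ⊗ₜ a : RepSpace n) = C • (f ⊗ₜ a : RepSpace n)) : B = C :=
  TensorProduct.ext' (g := (B : Module.End ℂ (RepSpace n))) (h := C) h

end RepEnd

namespace RepSpace

open RatFun (y perm)

variable {n : ℕ}

/-- Multiplication by a rational function. -/
noncomputable def mulFun : RatFun n →ₐ[ℂ] RepEnd n :=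
  AlgHom.comp (show RepSpace n →ₐ[ℂ] RepEnd n from Algebra.lmul ℂ (RepSpace n))
    Algebra.TensorProduct.includeLeft

/-- Left multiplication by an element of `OddAlg n`. -/
noncomputable def mulOdd : OddAlg n →ₐ[ℂ] RepEnd n :=
  AlgHom.comp (show RepSpace n →ₐ[ℂ] RepEnd n from Algebra.lmul ℂ (RepSpace n))
    Algebra.TensorProduct.includeRight

/-- Permutation of the coordinates in the factor `ℂ(y)`. -/
noncomputable def permOp (σ : Equiv.Perm (Fin n)) : RepEnd n :=
  show Module.End ℂ (RepSpace n) from TensorProduct.map (perm σ).toLinearMap LinearMap.id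

theorem mulFun_tmul (f g : RatFun n) (a : OddAlg n) :
    mulFun f • (g ⊗ₜ a : RepSpace n) = (f * g) ⊗ₜ a :=
  (Algebra.TensorProduct.tmul_mul_tmul f g 1 a).trans (by rw [one_mul])

theorem mulOdd_tmul (a b : OddAlg n) (f : RatFun n) :
    mulOdd a • (f ⊗ₜ b : RepSpace n) = f ⊗ₜ (a * b) :=
  (Algebra.TensorProduct.tmul_mul_tmul 1 f a b).trans (by rw [one_mul])

theorem permOp_tmul (σ : Equiv.Perm (Fin n)) (f : RatFun n) (a : OddAlg n) :
    permOp σ • (f ⊗ₜ a : RepSpace n) = perm σ f ⊗ₜ a := rfl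

theorem mulFun_mulOdd (f : RatFun n) (a : OddAlg n) :
    mulFun f * mulOdd a = mulOdd a * mulFun f :=
  RepEnd.ext fun g b => by simp [mul_smul, mulFun_tmul, mulOdd_tmul]

theorem permOp_mulFun (σ : Equiv.Perm (Fin n)) (f : RatFun n) :
    permOp σ * mulFun f = mulFun (perm σ f) * permOp σ :=
  RepEnd.ext fun g b => by simp [mul_smul, mulFun_tmul, permOp_tmul]

theorem permOp_mulOdd (σ : Equiv.Perm (Fin n)) (a : OddAlg n) :
    permOp σ * mulOdd a = mulOdd a * permOp σ :=
  RepEnd.ext fun g b => by simp [mul_smul, mulOdd_tmul, permOp_tmul]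

theorem permOp_mul (σ τ : Equiv.Perm (Fin n)) : permOp (σ * τ) = permOp σ * permOp τ :=
  RepEnd.ext fun g b => by simp [mul_smul, permOp_tmul, RatFun.perm_mul]

theorem permOp_one : permOp (1 : Equiv.Perm (Fin n)) = 1 :=
  RepEnd.ext fun g b => by simp [permOp_tmul, RatFun.perm_one]

/-- The operator by which `t_l` acts: `f ⊗ a ↦ s_l(f) ⊗ t_l a`. -/
noncomputable def tOp (l : Fin (n - 1)) : RepEnd n :=
  mulOdd (OddAlg.t l) * permOp (Equiv.swap (lo l) (hi l))

theorem mulOdd_permOp_mul (a b : OddAlg n) (σ τ : Equiv.Perm (Fin n)) :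
    mulOdd a * permOp σ * (mulOdd b * permOp τ) = mulOdd (a * b) * permOp (σ * τ) := by
  rw [mul_assoc, ← mul_assoc (permOp σ), permOp_mulOdd, permOp_mul, map_mul]
  simp only [mul_assoc]

theorem tOp_rel (a b : RepEnd n) (h : SpinSymRel tOp a b) : a = b := by
  cases h with
  | sq i =>
    rw [tOp, mulOdd_permOp_mul, t_mul_self OddAlg.t_rel, Equiv.swap_mul_self, permOp_one, map_one,
      one_mul]
  | braid i j h =>
    have e : hi i = lo j := Fin.ext (by simp [lo, hi, h])
    have h1 : lo i ≠ lo j := e ▸ lo_ne_hi i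
    have h2 : lo i ≠ hi j := by simp only [lo, hi, ne_eq, Fin.mk.injEq]; omega
    have hs : Equiv.swap (lo i) (hi i) * Equiv.swap (lo j) (hi j) * Equiv.swap (lo i) (hi i) =
        Equiv.swap (lo j) (hi j) * Equiv.swap (lo i) (hi i) * Equiv.swap (lo j) (hi j) := by
      rw [e, Equiv.swap_mul_swap_mul_swap h1 h2, Equiv.swap_comm (lo j), Equiv.swap_comm (lo i),
        Equiv.swap_mul_swap_mul_swap (lo_ne_hi j).symm h2.symm, Equiv.swap_comm]
    rw [tOp, tOp, mulOdd_permOp_mul, mulOdd_permOp_mul, mulOdd_permOp_mul, mulOdd_permOp_mul, hs,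
      OddAlg.t_rel _ _ (.braid i j h)]
  | anticomm i j h =>
    have hs : Equiv.swap (lo i) (hi i) * Equiv.swap (lo j) (hi j) =
        Equiv.swap (lo j) (hi j) * Equiv.swap (lo i) (hi i) := by
      refine (Equiv.Perm.disjoint_swap_swap ?_).commute.eq
      simp only [lo, hi, List.nodup_cons, List.mem_cons, Fin.mk.injEq, List.not_mem_nil, or_false,
        not_or, not_false_eq_true, List.nodup_nil, and_true]
      omega
    rw [tOp, tOp, mulOdd_permOp_mul, mulOdd_permOp_mul, hs, OddAlg.t_rel _ _ (.anticomm i j h),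
      map_neg, neg_mul]

theorem oddTransp_tOp (i j : Fin n) :
    oddTransp tOp i j = mulOdd (oddTransp OddAlg.t i j) * permOp (Equiv.swap i j) := by
  induction i, j using oddTransp_induction with
  | diag i => simp [oddTransp_self]
  | symm i j h =>
    rw [oddTransp_swap, h, oddTransp_swap OddAlg.t j i, map_neg, neg_mul, Equiv.swap_comm, neg_neg]
  | base l => rw [oddTransp_lo_hi, oddTransp_lo_hi, tOp]
  | step l i hi ih =>
    have e : Equiv.swap i (SpinDaha.hi l) = Equiv.swap (lo l) (SpinDaha.hi l) * Equiv.swap i (lo l)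
        * Equiv.swap (lo l) (SpinDaha.hi l) := by
      rw [Equiv.swap_mul_swap_mul_swap hi.ne (hi.trans (lo_lt_hi l)).ne, Equiv.swap_comm]
    rw [oddTransp_hi _ _ _ hi, oddTransp_hi _ _ _ hi, ih, tOp, mulOdd_permOp_mul,
      mulOdd_permOp_mul, e, map_neg, neg_mul]

theorem oddTransp_tOp_mulFun (i j : Fin n) (f : RatFun n) :
    oddTransp tOp i j * mulFun f = mulFun (perm (Equiv.swap i j) f) * oddTransp tOp i j := by
  rw [oddTransp_tOp, mul_assoc, permOp_mulFun, ← mul_assoc, ← mulFun_mulOdd, mul_assoc]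

theorem tOp_mulFun (l : Fin (n - 1)) (f : RatFun n) :
    tOp l * mulFun f = mulFun (perm (Equiv.swap (lo l) (hi l)) f) * tOp l := by
  rw [← oddTransp_lo_hi tOp, oddTransp_tOp_mulFun]

theorem tOp_mulOdd (l : Fin (n - 1)) {a b : OddAlg n} (h : OddAlg.t l * a = -(b * OddAlg.t l)) :
    tOp l * mulOdd a = -(mulOdd b * tOp l) := by
  rw [tOp, mul_assoc, permOp_mulOdd, ← mul_assoc, ← map_mul, h, map_neg, map_mul, neg_mul,
    mul_assoc]

/-- The operator by which `ξ_j` acts. It is `f ⊗ a ↦ f ⊗ ξ_j a - u ∑_k Δ_{jk}(f) ⊗ [j, k] a`, where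
`Δ_{jk}(f) = (f - s_{jk} f) / (y_j - y_k)`. The term with `k = j` vanishes. -/
noncomputable def xiOp (u : ℂ) (j : Fin n) : RepEnd n :=
  mulOdd (OddAlg.xi j) - u • ∑ k, mulFun (y j - y k)⁻¹ *
    (mulOdd (oddTransp OddAlg.t j k) - oddTransp tOp j k)

theorem tOp_xiOp (u : ℂ) (l : Fin (n - 1)) (j : Fin n) :
    tOp l * xiOp u j = -(xiOp u (Equiv.swap (lo l) (hi l) j) * tOp l) := by
  set s := Equiv.swap (lo l) (hi l) with hs
  have h : ∀ k, tOp l * (mulFun (y j - y k)⁻¹ *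
      (mulOdd (oddTransp OddAlg.t j k) - oddTransp tOp j k)) =
      -(mulFun (y (s j) - y (s k))⁻¹ *
        (mulOdd (oddTransp OddAlg.t (s j) (s k)) - oddTransp tOp (s j) (s k)) * tOp l) := by
    intro k
    rw [← mul_assoc, tOp_mulFun, mul_assoc, mul_sub,
      tOp_mulOdd l (t_mul_oddTransp OddAlg.t_rel l j k), t_mul_oddTransp tOp_rel, map_inv₀, map_sub,
      RatFun.perm_y, RatFun.perm_y, ← hs, mul_assoc, sub_mul, mul_sub, mul_sub, mul_neg, mul_neg]
    abel
  rw [xiOp, xiOp, mul_sub, tOp_mulOdd l (OddAlg.t_mul_xi l j), mul_smul_comm, Finset.mul_sum,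
    Finset.sum_congr rfl fun k _ => h k, Finset.sum_neg_distrib, Equiv.sum_comp s fun k =>
      mulFun (y (s j) - y k)⁻¹ *
        (mulOdd (oddTransp OddAlg.t (s j) k) - oddTransp tOp (s j) k) * tOp l,
    sub_mul, smul_mul_assoc, Finset.sum_mul, smul_neg]
  abel

theorem mulFun_xiOp (u : ℂ) (f : RatFun n) (j : Fin n) :
    mulFun f * xiOp u j - xiOp u j * mulFun f = u • ∑ k,
      mulFun ((f - perm (Equiv.swap j k) f) / (y j - y k)) * oddTransp tOp j k := by
  have h : ∀ k, mulFun ((f - perm (Equiv.swap j k) f) / (y j - y k)) * oddTransp tOp j k =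
      mulFun (y j - y k)⁻¹ * (mulOdd (oddTransp OddAlg.t j k) - oddTransp tOp j k) * mulFun f -
      mulFun f *
        (mulFun (y j - y k)⁻¹ * (mulOdd (oddTransp OddAlg.t j k) - oddTransp tOp j k)) := by
    intro k
    rw [mul_assoc, sub_mul, oddTransp_tOp_mulFun, ← mulFun_mulOdd, ← mul_assoc (mulFun f),
      ← map_mul, mul_comm f, map_mul, mul_assoc (mulFun (y j - y k)⁻¹) (mulFun f), ← mul_sub,
      div_eq_inv_mul, map_mul, mul_assoc]
    congr 1
    rw [map_sub, sub_mul, mul_sub]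
    abel
  rw [Finset.sum_congr rfl fun k _ => h k, Finset.sum_sub_distrib, ← Finset.sum_mul,
    ← Finset.mul_sum, xiOp, mul_sub, sub_mul, mulFun_mulOdd, mul_smul_comm, smul_mul_assoc,
    smul_sub]
  abel

theorem mulFun_y_xiOp (u : ℂ) (i j : Fin n) (h : i ≠ j) :
    mulFun (y i) * xiOp u j - xiOp u j * mulFun (y i) = u • oddTransp tOp i j := by
  rw [mulFun_xiOp, Finset.sum_eq_single i, RatFun.perm_y, Equiv.swap_apply_right, oddTransp_swap]
  · have e : (y i - y j) / (y j - y i) = -1 := by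
      rw [div_eq_iff (sub_ne_zero.mpr fun e => h (RatFun.y_injective e).symm)]
      ring
    rw [e, map_neg, map_one, neg_mul, one_mul, neg_neg]
  · intro k _ hk
    rw [RatFun.perm_y, Equiv.swap_apply_of_ne_of_ne h hk.symm]
    simp
  · simp

theorem mulFun_y_xiOp_self (u : ℂ) (i : Fin n) :
    mulFun (y i) * xiOp u i - xiOp u i * mulFun (y i) = u • ∑ k, oddTransp tOp i k := by
  rw [mulFun_xiOp]
  congr 1
  refine Finset.sum_congr rfl fun k _ => ?_
  rw [RatFun.perm_y, Equiv.swap_apply_left]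
  by_cases h : i = k
  · subst h; rw [oddTransp_self, mul_zero]
  · rw [div_self (sub_ne_zero.mpr fun e => h (RatFun.y_injective e)), map_one, one_mul]

theorem oddTransp_tOp_xiOp (u : ℂ) (i j k : Fin n) :
    oddTransp tOp i j * xiOp u k = -(xiOp u (Equiv.swap i j k) * oddTransp tOp i j) :=
  oddTransp_mul_of_odd _ (tOp_xiOp u) i j k

theorem xiOp_one_tmul (u : ℂ) (j : Fin n) (a : OddAlg n) :
    xiOp u j • (1 ⊗ₜ a : RepSpace n) = 1 ⊗ₜ (OddAlg.xi j * a) := by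
  simp [xiOp, oddTransp_tOp, mulOdd_tmul, permOp_tmul, mul_smul, sub_smul, Finset.sum_smul]

/-- An operator commuting with all coordinate functions commutes with all rational functions. -/
theorem commute_mulFun {B : RepEnd n} (h : ∀ i, Commute (mulFun (y i)) B)
    (f : RatFun n) : Commute (mulFun f) B := by
  have hp : ∀ p : MvPolynomial (Fin n) ℂ, Commute (mulFun (algebraMap _ _ p)) B := by
    intro p
    induction p using MvPolynomial.induction_on with
    | C c =>
      have e : mulFun (algebraMap _ (RatFun n) (MvPolynomial.C c : MvPolynomial (Fin n) ℂ)) =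
          algebraMap ℂ (RepEnd n) c :=
        (mulFun (n := n)).commutes c
      rw [e]
      exact Algebra.commutes c B
    | add p q hp hq => rw [map_add, map_add]; exact hp.add_left hq
    | mul_X p i hp => rw [map_mul, map_mul]; exact hp.mul_left (h i)
  obtain ⟨p, q, hq, rfl⟩ := IsFractionRing.div_surjective (MvPolynomial (Fin n) ℂ) f
  rw [div_eq_mul_inv, map_mul]
  refine (hp p).mul_left ?_
  have hq0 : algebraMap _ (RatFun n) q ≠ 0 := by simpa using nonZeroDivisors.ne_zero hq
  have h1 : mulFun (algebraMap _ (RatFun n) q) * mulFun (algebraMap _ (RatFun n) q)⁻¹ = 1 := by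
    rw [← map_mul, mul_inv_cancel₀ hq0, map_one]
  have h2 : mulFun (algebraMap _ (RatFun n) q)⁻¹ * mulFun (algebraMap _ (RatFun n) q) = 1 := by
    rw [← map_mul, inv_mul_cancel₀ hq0, map_one]
  exact Commute.units_inv_left (u := Units.mk _ _ h1 h2) (hp q)

/-- The anticommutator of `xiOp u i` and `xiOp u j` commutes with the coordinate function `y_i`
(the Jacobi identity). -/
theorem commute_anticommutator_self (u : ℂ) (i j : Fin n) (h : i ≠ j) :
    Commute (mulFun (y i)) (xiOp u i * xiOp u j + xiOp u j * xiOp u i) := by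
  have h1 := mulFun_y_xiOp u i j h
  have h2 := mulFun_y_xiOp_self u i
  have h3 : (∑ k, oddTransp tOp i k) * xiOp u j + xiOp u j * ∑ k, oddTransp tOp i k =
      (xiOp u j - xiOp u i) * oddTransp tOp i j := by
    rw [Finset.sum_mul, Finset.mul_sum, ← Finset.sum_add_distrib, Finset.sum_eq_single j]
    · rw [oddTransp_tOp_xiOp, Equiv.swap_apply_right, sub_mul]; abel
    · intro k _ hk
      rw [oddTransp_tOp_xiOp, Equiv.swap_apply_of_ne_of_ne h.symm hk.symm]; abel
    · simp
  have h4 := oddTransp_tOp_xiOp u i j i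
  rw [Equiv.swap_apply_left] at h4
  set Y := mulFun (y i)
  set T := oddTransp tOp i j
  set S := ∑ k, oddTransp tOp i k
  set a := xiOp u i
  set b := xiOp u j
  refine sub_eq_zero.mp ?_
  calc Y * (a * b + b * a) - (a * b + b * a) * Y
      = (Y * a - a * Y) * b + a * (Y * b - b * Y) + (Y * b - b * Y) * a + b * (Y * a - a * Y) := by
        noncomm_ring
    _ = u • ((S * b + b * S) + (a * T + T * a)) := by
        rw [h1, h2]; simp only [smul_add, smul_mul_assoc, mul_smul_comm]; abel
    _ = 0 := by rw [h3, h4, sub_mul, ← add_assoc, sub_add_cancel, add_neg_cancel, smul_zero]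

theorem xiOp_mul_xiOp (u : ℂ) (i j : Fin n) (h : i ≠ j) :
    xiOp u i * xiOp u j = -(xiOp u j * xiOp u i) := by
  have hy : ∀ l, Commute (mulFun (y l)) (xiOp u i * xiOp u j + xiOp u j * xiOp u i) := by
    intro l
    by_cases hi : l = i
    · subst hi; exact commute_anticommutator_self u l j h
    by_cases hj : l = j
    · subst hj; rw [add_comm]; exact commute_anticommutator_self u l i h.symm
    have h1 := mulFun_y_xiOp u l i hi
    have h2 := mulFun_y_xiOp u l j hj
    have h3 := oddTransp_tOp_xiOp u l j i
    have h4 := oddTransp_tOp_xiOp u l i j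
    rw [Equiv.swap_apply_of_ne_of_ne (Ne.symm hi) h] at h3
    rw [Equiv.swap_apply_of_ne_of_ne (Ne.symm hj) h.symm] at h4
    set Y := mulFun (y l)
    set a := xiOp u i
    set b := xiOp u j
    refine sub_eq_zero.mp ?_
    calc Y * (a * b + b * a) - (a * b + b * a) * Y
        = (Y * a - a * Y) * b + a * (Y * b - b * Y) + (Y * b - b * Y) * a +
            b * (Y * a - a * Y) := by
          noncomm_ring
      _ = 0 := by
          rw [h1, h2]; simp only [smul_mul_assoc, mul_smul_comm, h3, h4, smul_neg]; abel
  rw [← add_eq_zero_iff_eq_neg]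
  refine RepEnd.ext fun f a => ?_
  -- The anticommutator commutes with `ℂ(y)` and annihilates `1 ⊗ OddAlg n`.
  have h1 : (f ⊗ₜ a : RepSpace n) = mulFun f • (1 ⊗ₜ a : RepSpace n) := by
    rw [mulFun_tmul, mul_one]
  rw [h1, ← mul_smul, ← (commute_mulFun hy f).eq, mul_smul, add_smul, mul_smul, mul_smul,
    xiOp_one_tmul, xiOp_one_tmul, xiOp_one_tmul, xiOp_one_tmul, ← mul_assoc,
    OddAlg.xi_mul_xi i j h, ← TensorProduct.tmul_add, neg_mul, mul_assoc, neg_add_cancel,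
    TensorProduct.tmul_zero, smul_zero, zero_smul]

/-- The faithful representation of `RatDaha n u`. -/
noncomputable def rep (u : ℂ) : RatDaha n u →ₐ[ℂ] RepEnd n :=
  RatDaha.lift u (xiOp u) (fun i => mulFun (y i)) tOp tOp_rel (xiOp_mul_xiOp u)
    (fun i j _ => by rw [← map_mul, mul_comm, map_mul]) (tOp_xiOp u)
    (fun l m => by rw [tOp_mulFun, RatFun.perm_y]) (mulFun_y_xiOp u)
    (fun i => by
      rw [mulFun_y_xiOp_self, Finset.sum_filter_of_ne]
      rintro k - hk rfl
      exact hk (oddTransp_self _ _))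

end RepSpace

/-! ### Faithfulness of the representation -/

theorem oddTransp_mem {n : ℕ} {A S : Type*} [Ring A] [SetLike S A] [SubringClass S A] (s : S)
    {t : Fin (n - 1) → A} (ht : ∀ l, t l ∈ s) (i j : Fin n) : oddTransp t i j ∈ s := by
  induction i, j using oddTransp_induction with
  | diag i => rw [oddTransp_self]; exact zero_mem s
  | symm i j h => rw [oddTransp_swap]; exact neg_mem h
  | base l => rw [oddTransp_lo_hi]; exact ht l
  | step l i hi ih =>
    rw [oddTransp_hi _ _ _ hi]
    exact neg_mem (mul_mem (mul_mem (ht l) ih) (ht l))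

namespace RatDaha

variable {n : ℕ} (u : ℂ)

/-- The generators generate `RatDaha n u`. -/
theorem mem_of_gen_mem (s : Subalgebra ℂ (RatDaha n u)) (hx : ∀ i, xi u i ∈ s) (hy : ∀ i, y u i ∈ s)
    (ht : ∀ l, t u l ∈ s) (h : RatDaha n u) : h ∈ s := by
  obtain ⟨w, rfl⟩ := RingQuot.mkAlgHom_surjective ℂ (RatRel n u) h
  induction w using FreeAlgebra.induction with
  | grade0 c => rw [AlgHom.commutes]; exact s.algebraMap_mem c
  | grade1 g =>
    cases g with
    | xi i => exact hx i
    | y i => exact hy i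
    | t l => exact ht l
  | mul a b ha hb => rw [map_mul]; exact s.mul_mem ha hb
  | add a b ha hb => rw [map_add]; exact s.add_mem ha hb

/-- The canonical homomorphism `OddAlg n → RatDaha n u`. -/
noncomputable def ofOdd : OddAlg n →ₐ[ℂ] RatDaha n u :=
  OddAlg.lift (xi u) (t u) (t_rel u) (xi_mul_xi u) (t_mul_xi u)

/-- Multiplication `ℂ[y] ⊗ OddAlg n → RatDaha n u`. It is bijective: this is the
Poincaré–Birkhoff–Witt decomposition with respect to the variables `y_i`. -/
noncomputable def mulMap : MvPolynomial (Fin n) ℂ ⊗[ℂ] OddAlg n →ₗ[ℂ] RatDaha n u :=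
  LinearMap.mul' ℂ (RatDaha n u) ∘ₗ
    TensorProduct.map (polyHom u).toLinearMap (ofOdd u).toLinearMap

theorem mulMap_tmul (p : MvPolynomial (Fin n) ℂ) (a : OddAlg n) :
    mulMap u (p ⊗ₜ a) = polyHom u p * ofOdd u a := rfl

theorem polyHom_C (c : ℂ) : polyHom (n := n) u (MvPolynomial.C c) = algebraMap ℂ _ c :=
  (polyHom u).commutes c

theorem t_mul_polyHom (l : Fin (n - 1)) (p : MvPolynomial (Fin n) ℂ) :
    t u l * polyHom u p =
      polyHom u (MvPolynomial.rename (Equiv.swap (lo l) (hi l)) p) * t u l := by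
  induction p using MvPolynomial.induction_on with
  | C c =>
    rw [MvPolynomial.rename_C, polyHom_C, Algebra.commutes]
  | add p q hp hq => simp only [map_add, mul_add, add_mul, hp, hq]
  | mul_X p i hp =>
    rw [map_mul, map_mul, map_mul, MvPolynomial.rename_X, polyHom_X, polyHom_X, ← mul_assoc, hp,
      mul_assoc, t_mul_y, mul_assoc]

/-- The elements that preserve the range of `mulMap` under left multiplication. -/
noncomputable def rangeStabilizer : Subalgebra ℂ (RatDaha n u) where
  carrier := {h | ∀ w ∈ LinearMap.range (mulMap u), h * w ∈ LinearMap.range (mulMap u)}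
  mul_mem' {g h} hg hh w hw := by
    rw [mul_assoc]
    exact hg _ (hh w hw)
  add_mem' {g h} hg hh w hw := by
    rw [add_mul]
    exact add_mem (hg w hw) (hh w hw)
  algebraMap_mem' c w hw := by
    rw [← Algebra.smul_def]
    exact Submodule.smul_mem _ _ hw

theorem mem_rangeStabilizer {h : RatDaha n u}
    (hh : ∀ p a, h * (polyHom u p * ofOdd u a) ∈ LinearMap.range (mulMap u)) :
    h ∈ rangeStabilizer u := by
  rintro _ ⟨z, rfl⟩
  induction z using TensorProduct.induction_on with
  | zero => rw [map_zero, mul_zero]; exact zero_mem _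
  | tmul p a => exact hh p a
  | add z w hz hw => rw [map_add, mul_add]; exact add_mem hz hw

theorem mulMap_surjective : Function.Surjective (mulMap (n := n) u) := by
  have hy : ∀ i, y u i ∈ rangeStabilizer (n := n) u := fun i => mem_rangeStabilizer u fun p a =>
    ⟨(.X i * p) ⊗ₜ a, by rw [mulMap_tmul, map_mul, polyHom_X, mul_assoc]⟩
  have ht : ∀ l, t u l ∈ rangeStabilizer (n := n) u := fun l => mem_rangeStabilizer u fun p a =>
    ⟨MvPolynomial.rename (Equiv.swap (lo l) (hi l)) p ⊗ₜ (OddAlg.t l * a), by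
      rw [mulMap_tmul, map_mul, ofOdd, OddAlg.lift_t, ← mul_assoc, ← t_mul_polyHom, mul_assoc]⟩
  have hx : ∀ j, xi u j ∈ rangeStabilizer (n := n) u := by
    intro j
    refine mem_rangeStabilizer u fun p => ?_
    induction p using MvPolynomial.induction_on with
    | C c =>
      intro a
      refine ⟨MvPolynomial.C c ⊗ₜ (OddAlg.xi j * a), ?_⟩
      rw [mulMap_tmul, map_mul, ofOdd, OddAlg.lift_xi, polyHom_C, ← mul_assoc, Algebra.commutes,
        mul_assoc]
    | add p q hp hq =>
      intro a
      rw [map_add, add_mul, mul_add]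
      exact add_mem (hp a) (hq a)
    | mul_X p i hp =>
      intro a
      -- The commutator lies in the subalgebra generated by the `t_l`.
      have hc : y u i * xi u j - xi u j * y u i ∈ rangeStabilizer (n := n) u := by
        by_cases hij : i = j
        · subst hij
          rw [y_xi_self]
          exact Subalgebra.smul_mem _ (sum_mem fun k _ => oddTransp_mem _ ht i k) u
        · rw [y_xi u i j hij]
          exact Subalgebra.smul_mem _ (oddTransp_mem _ ht i j) u
      have h := sub_mem (hy i _ (hp a)) (hc _ ⟨p ⊗ₜ a, rfl⟩)
      rw [mul_comm p, map_mul, polyHom_X]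
      simpa only [mulMap_tmul, sub_mul, mul_assoc, sub_sub_cancel] using h
  intro h
  have := mem_of_gen_mem u (rangeStabilizer u) hx hy ht h 1 ⟨1 ⊗ₜ 1, by
    rw [mulMap_tmul, map_one, map_one, one_mul]⟩
  rwa [mul_one] at this

end RatDaha

namespace RepSpace

open RatFun (y perm)

variable {n : ℕ} (u : ℂ)

theorem rep_xi (i : Fin n) : rep u (RatDaha.xi u i) = xiOp u i := RatDaha.lift_xi i

theorem rep_y (i : Fin n) : rep u (RatDaha.y u i) = mulFun (y i) := RatDaha.lift_y i

theorem rep_t (l : Fin (n - 1)) : rep u (RatDaha.t u l) = tOp l := RatDaha.lift_t l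

theorem rep_polyHom (p : MvPolynomial (Fin n) ℂ) :
    rep u (RatDaha.polyHom u p) = mulFun (algebraMap _ _ p) := by
  have : (rep u).comp (RatDaha.polyHom u) =
      mulFun.comp (IsScalarTower.toAlgHom ℂ (MvPolynomial (Fin n) ℂ) (RatFun n)) :=
    MvPolynomial.algHom_ext fun i => by
      rw [AlgHom.comp_apply, RatDaha.polyHom_X, rep_y]
      rfl
  exact DFunLike.congr_fun this p

theorem rep_ofOdd_one_tmul (a b : OddAlg n) :
    rep u (RatDaha.ofOdd u a) • (1 ⊗ₜ b : RepSpace n) = 1 ⊗ₜ (a * b) := by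
  induction a using OddAlg.induction generalizing b with
  | hC c =>
    rw [AlgHom.commutes, AlgHom.commutes, algebraMap_smul, ← Algebra.smul_def,
      TensorProduct.tmul_smul]
  | hx i => rw [RatDaha.ofOdd, OddAlg.lift_xi, rep_xi, xiOp_one_tmul]
  | ht l =>
    rw [RatDaha.ofOdd, OddAlg.lift_t, rep_t, tOp, mul_smul, permOp_tmul, mulOdd_tmul, map_one]
  | hadd a a' h h' => rw [map_add, map_add, add_smul, h, h', add_mul, TensorProduct.tmul_add]
  | hmul a a' h h' => rw [map_mul, map_mul, mul_smul, h', h, mul_assoc]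

theorem rep_mulMap_one (z : MvPolynomial (Fin n) ℂ ⊗[ℂ] OddAlg n) :
    rep u (RatDaha.mulMap u z) • (1 ⊗ₜ 1 : RepSpace n) =
      LinearMap.rTensor (OddAlg n)
        (IsScalarTower.toAlgHom ℂ (MvPolynomial (Fin n) ℂ) (RatFun n)).toLinearMap z := by
  induction z using TensorProduct.induction_on with
  | zero => rw [map_zero, map_zero, map_zero, zero_smul]
  | tmul p a =>
    rw [RatDaha.mulMap_tmul, map_mul, mul_smul, rep_ofOdd_one_tmul, rep_polyHom, mulFun_tmul,
      mul_one, mul_one]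
    rfl
  | add z w hz hw => rw [map_add, map_add, map_add, add_smul, hz, hw]

/-- In terms of the spanning set `p(y) a` of `RatDaha n u`, evaluation of the representation at
`1 ⊗ 1` is the inclusion of `ℂ[y] ⊗ OddAlg n` into `ℂ(y) ⊗ OddAlg n`. -/
theorem rep_injective : Function.Injective (rep (n := n) u) := by
  rw [injective_iff_map_eq_zero]
  intro h hh
  obtain ⟨z, rfl⟩ := RatDaha.mulMap_surjective u h
  have h1 := rep_mulMap_one u z
  rw [hh, zero_smul] at h1
  have h2 := Module.Flat.rTensor_preserves_injective_linearMap (M := OddAlg n)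
    (IsScalarTower.toAlgHom ℂ (MvPolynomial (Fin n) ℂ) (RatFun n)).toLinearMap
    (IsFractionRing.injective (MvPolynomial (Fin n) ℂ) (RatFun n))
  rw [h2 (h1.symm.trans (map_zero _).symm), map_zero]

/-- Multiplication by a symmetric function commutes with the whole representation. -/
theorem commute_rep_of_symmetric {f : RatFun n} (hf : ∀ σ, perm σ f = f) (h : RatDaha n u) :
    Commute (mulFun f) (rep u h) := by
  refine RatDaha.mem_of_gen_mem u
    ((Subalgebra.centralizer ℂ {mulFun f}).comap (rep u)) ?_ ?_ ?_ h (mulFun f) rfl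
  · rintro i _ rfl
    refine sub_eq_zero.mp ?_
    simp only [RingHom.coe_coe, rep_xi]
    rw [mulFun_xiOp, Finset.sum_eq_zero, smul_zero]
    intro k _
    rw [hf, sub_self, zero_div, map_zero, zero_mul]
  · rintro i _ rfl
    simp only [RingHom.coe_coe, rep_y]
    rw [← map_mul, mul_comm, map_mul]
  · rintro l _ rfl
    simp only [RingHom.coe_coe, rep_t]
    rw [tOp_mulFun, hf]

end RepSpace

/-- The product `y_1 ⋯ y_n` in `ℂ[y]`, which is inverted in `ℂ[y^±]`. -/
noncomputable abbrev prodX (n : ℕ) : MvPolynomial (Fin n) ℂ := ∏ i : Fin n, MvPolynomial.X i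

/-- `y_1 ⋯ y_n` is central, being symmetric: divided differences of it vanish. -/
theorem RatDaha.commute_polyHom_prodX {n : ℕ} (u : ℂ) (h : RatDaha n u) :
    Commute (RatDaha.polyHom u (prodX n)) h := by
  refine RepSpace.rep_injective u ?_
  rw [map_mul, map_mul, RepSpace.rep_polyHom]
  refine RepSpace.commute_rep_of_symmetric u (fun σ => ?_) h
  rw [RatFun.perm_algebraMap, prodX, map_prod]
  simp only [MvPolynomial.rename_X]
  rw [Equiv.prod_comp σ (fun i => (MvPolynomial.X i : MvPolynomial (Fin n) ℂ))]

/-! ### The trigonometric algebra acts on the same space -/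

namespace RatFun

variable {n : ℕ}

/-- The monomial `∏ y_i ^ η_i`. -/
noncomputable def yexp : Multiplicative (Fin n → ℤ) →* RatFun n where
  toFun η := ∏ i, y i ^ (η.toAdd i)
  map_one' := by simp
  map_mul' η θ := by
    rw [← Finset.prod_mul_distrib]
    exact Finset.prod_congr rfl fun i _ => zpow_add₀ (y_ne_zero i) _ _

/-- The embedding `e^{ε_i} ↦ y_i` of `ℂ[P]` into `ℂ(y)`. -/
noncomputable def ofLattice : LatticeAlg n →ₐ[ℂ] RatFun n :=
  AddMonoidAlgebra.lift ℂ (RatFun n) (Fin n → ℤ) yexp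

theorem ofLattice_lexp (η : Fin n → ℤ) : ofLattice (lexp η) = ∏ i, y i ^ η i := by
  rw [ofLattice, lexp, AddMonoidAlgebra.lift_single, one_smul]
  rfl

theorem ofLattice_apply (q : LatticeAlg n) :
    ofLattice q = q.coeff.sum fun η a => a • ofLattice (lexp η) := by
  simp only [ofLattice_lexp]
  rw [ofLattice, AddMonoidAlgebra.lift_apply]
  rfl

theorem perm_ofLattice_lexp (k i : Fin n) (η : Fin n → ℤ) :
    perm (Equiv.swap k i) (ofLattice (lexp η)) = ofLattice (lexp (swapAct k i η)) := by
  rw [ofLattice_lexp, ofLattice_lexp, map_prod, ← Equiv.prod_comp (Equiv.swap k i)]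
  refine Finset.prod_congr rfl fun l _ => ?_
  rw [map_zpow₀, perm_y, Equiv.swap_apply_self, swapAct]

theorem ofLattice_root (k i : Fin n) (c : ℤ) :
    ofLattice (lexp (c • (Pi.single k 1 - Pi.single i 1))) = (y k / y i) ^ c := by
  have e : ∀ (j : Fin n) (d : ℤ), ofLattice (lexp (d • Pi.single j 1)) = y j ^ d := by
    intro j d
    rw [ofLattice_lexp, Finset.prod_eq_single j] <;> simp +contextual
  rw [smul_sub, sub_eq_add_neg, ← neg_smul, ← lexp_mul, map_mul, e, e, div_zpow, zpow_neg,
    div_eq_mul_inv]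

/-- The coefficient of `[k, i]` in the relation between `ζ_i` and `e^η`. -/
theorem sgn_smul_ofLattice {k i : Fin n} (h : k ≠ i) {η : Fin n → ℤ} {q : LatticeAlg n}
    (hq : IsDivDiff k i η q) {f : RatFun n} (hf : f = ofLattice (lexp η)) :
    (sgn k i : ℂ) • ofLattice q = y i * ((f - perm (Equiv.swap k i) f) / (y i - y k)) +
      if k < i then perm (Equiv.swap k i) f - f else 0 := by
  have h1 := congrArg ofLattice hq
  rw [map_mul, map_sub, map_sub, map_one, ofLattice_root k i, ← perm_ofLattice_lexp, ← hf] at h1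
  have hi := y_ne_zero i
  have hk := y_ne_zero k
  have hik : y i - y k ≠ 0 := sub_ne_zero.mpr fun e => h (y_injective e).symm
  generalize perm (Equiv.swap k i) f = g at h1 ⊢
  by_cases hki : k < i
  · have : sgn k i = -1 := Int.sign_eq_neg_one_of_neg (by rw [Fin.lt_def] at hki; omega)
    rw [this] at h1 ⊢
    rw [if_pos hki, ← neg_sub f g, ← h1]
    simp only [Int.cast_neg, Int.cast_one, neg_smul, one_smul, zpow_neg, zpow_one]
    field_simp
    ring
  · have : sgn k i = 1 := Int.sign_eq_one_of_pos (by
      rw [Fin.lt_def] at hki; have : (k : ℕ) ≠ i := fun e => h (Fin.ext e); omega)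
    rw [this] at h1 ⊢
    rw [if_neg hki, ← h1]
    simp only [Int.cast_one, one_smul, zpow_one]
    field_simp
    ring

end RatFun

namespace RepSpace

open RatFun (y perm ofLattice)

variable {n : ℕ} (u : ℂ)

/-- The operator by which `ζ_i` acts. -/
noncomputable def zetaOp (i : Fin n) : RepEnd n :=
  mulFun (y i) * xiOp u i + u • oddJM tOp i

theorem zetaOp_mulFun (i : Fin n) (f : RatFun n) :
    zetaOp u i * mulFun f - mulFun f * zetaOp u i =
      u • ∑ k ∈ Finset.univ.filter (fun k => k ≠ i),
        mulFun (y i * ((f - perm (Equiv.swap k i) f) / (y i - y k)) +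
          if k < i then perm (Equiv.swap k i) f - f else 0) * oddTransp tOp k i := by
  have h1 : zetaOp u i * mulFun f - mulFun f * zetaOp u i =
      -(mulFun (y i) * (mulFun f * xiOp u i - xiOp u i * mulFun f)) +
        u • (oddJM tOp i * mulFun f - mulFun f * oddJM tOp i) := by
    have : mulFun f * (mulFun (y i) * xiOp u i) = mulFun (y i) * (mulFun f * xiOp u i) := by
      rw [← mul_assoc, ← map_mul, mul_comm f, map_mul, mul_assoc]
    rw [zetaOp, add_mul, mul_add, this, mul_sub, smul_mul_assoc, mul_smul_comm, smul_sub, mul_assoc]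
    abel
  have h2 : oddJM tOp i * mulFun f - mulFun f * oddJM tOp i =
      ∑ k ∈ Finset.univ.filter (fun k => k ≠ i),
        mulFun (if k < i then perm (Equiv.swap k i) f - f else 0) * oddTransp tOp k i := by
    have h3 : ∀ k, k ∈ Finset.univ.filter (fun k : Fin n => k ≠ i) →
        mulFun (if k < i then perm (Equiv.swap k i) f - f else 0) * oddTransp tOp k i =
        if k < i then oddTransp tOp k i * mulFun f - mulFun f * oddTransp tOp k i else 0 := by
      intro k _
      split_ifs
      · rw [oddTransp_tOp_mulFun, map_sub, sub_mul]
      · rw [map_zero, zero_mul]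
    rw [Finset.sum_congr rfl h3, ← Finset.sum_filter, Finset.filter_filter, oddJM, Finset.sum_mul,
      Finset.mul_sum, ← Finset.sum_sub_distrib]
    refine Finset.sum_congr ?_ fun _ _ => rfl
    ext k
    simpa using fun h => ne_of_lt h
  have h4 : ∑ k, mulFun ((f - perm (Equiv.swap i k) f) / (y i - y k)) * oddTransp tOp i k =
      ∑ k ∈ Finset.univ.filter (fun k => k ≠ i),
        -(mulFun ((f - perm (Equiv.swap k i) f) / (y i - y k)) * oddTransp tOp k i) := by
    rw [← Finset.sum_filter_of_ne (p := fun k => k ≠ i)]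
    · refine Finset.sum_congr rfl fun k _ => ?_
      rw [oddTransp_swap, Equiv.swap_comm, mul_neg]
    · rintro k - hk rfl
      exact hk (by rw [oddTransp_self, mul_zero])
  rw [h1, h2, mulFun_xiOp, h4, mul_smul_comm, ← smul_neg, ← smul_add, Finset.mul_sum,
    ← Finset.sum_neg_distrib, ← Finset.sum_add_distrib]
  congr 1
  refine Finset.sum_congr rfl fun k _ => ?_
  rw [map_add, add_mul, mul_neg, neg_neg, ← mul_assoc, ← map_mul]

theorem oddTransp_tOp_y_xiOp (i j k : Fin n) :
    oddTransp tOp i j * (mulFun (y k) * xiOp u k) =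
      -(mulFun (y (Equiv.swap i j k)) * xiOp u (Equiv.swap i j k) * oddTransp tOp i j) := by
  rw [← mul_assoc, oddTransp_tOp_mulFun, mul_assoc, oddTransp_tOp_xiOp, RatFun.perm_y, mul_neg,
    mul_assoc]

theorem zetaOp_mul_tOp (l : Fin (n - 1)) :
    zetaOp u (hi l) * tOp l + tOp l * zetaOp u (lo l) = algebraMap ℂ _ u := by
  have h := oddTransp_tOp_y_xiOp u (lo l) (hi l) (lo l)
  rw [Equiv.swap_apply_left, oddTransp_lo_hi] at h
  rw [zetaOp, zetaOp, mul_add, h, oddJM_hi, Algebra.algebraMap_eq_smul_one]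
  simp only [add_mul, sub_mul, smul_mul_assoc, mul_smul_comm, smul_sub, t_mul_self tOp_rel,
    mul_assoc, mul_one]
  abel

theorem zetaOp_mul_tOp' (l : Fin (n - 1)) (j : Fin n) (h : j ≠ lo l) (h' : j ≠ hi l) :
    zetaOp u j * tOp l = -(tOp l * zetaOp u j) := by
  have h1 := oddTransp_tOp_y_xiOp u (lo l) (hi l) j
  rw [Equiv.swap_apply_of_ne_of_ne h h', oddTransp_lo_hi] at h1
  rw [zetaOp, mul_add, h1, mul_smul_comm, t_mul_oddJM tOp_rel l j h h', add_mul, smul_mul_assoc,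
    smul_neg]
  abel

/-- For `i < j` only the summand `[i, j]` of the odd Jucys–Murphy element of index `j` fails to
anticommute with `y_i ξ_i`; its contribution cancels the anticommutator of `y_i ξ_i` and
`y_j ξ_j`. -/
theorem zetaOp_mul_zetaOp (i j : Fin n) (h : i ≠ j) :
    zetaOp u i * zetaOp u j = -(zetaOp u j * zetaOp u i) := by
  wlog hij : i < j generalizing i j
  · rw [this j i h.symm (lt_of_le_of_ne (not_lt.mp hij) h.symm), neg_neg]
  have hMM := oddJM_mul_oddJM tOp_rel i j h
  have hM : oddJM tOp i * (mulFun (y j) * xiOp u j) =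
      -(mulFun (y j) * xiOp u j * oddJM tOp i) := by
    rw [oddJM, Finset.sum_mul, Finset.mul_sum, ← Finset.sum_neg_distrib]
    refine Finset.sum_congr rfl fun k hk => ?_
    have hk : k < i := by simpa using hk
    rw [oddTransp_tOp_y_xiOp, Equiv.swap_apply_of_ne_of_ne (hk.trans hij).ne' hij.ne']
  have hT : oddTransp tOp i j * (mulFun (y i) * xiOp u i) =
      -(mulFun (y j) * xiOp u j * oddTransp tOp i j) := by
    rw [oddTransp_tOp_y_xiOp, Equiv.swap_apply_left]
  have hN : oddJM tOp j * (mulFun (y i) * xiOp u i) + mulFun (y i) * xiOp u i * oddJM tOp j =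
      (mulFun (y i) * xiOp u i - mulFun (y j) * xiOp u j) * oddTransp tOp i j := by
    rw [oddJM, Finset.sum_mul, Finset.mul_sum, ← Finset.sum_add_distrib,
      Finset.sum_eq_single i]
    · rw [hT, sub_mul]; abel
    · intro k hk hki
      rw [oddTransp_tOp_y_xiOp, Equiv.swap_apply_of_ne_of_ne (Ne.symm hki) h]; abel
    · intro hi'; simp [hij] at hi'
  have hX : mulFun (y i) * xiOp u i * (mulFun (y j) * xiOp u j) +
      mulFun (y j) * xiOp u j * (mulFun (y i) * xiOp u i) =
      u • ((mulFun (y j) * xiOp u j - mulFun (y i) * xiOp u i) * oddTransp tOp i j) := by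
    have e1 : xiOp u i * mulFun (y j) = mulFun (y j) * xiOp u i + u • oddTransp tOp i j := by
      rw [oddTransp_swap, smul_neg, ← mulFun_y_xiOp u j i h.symm]; abel
    have e2 : xiOp u j * mulFun (y i) = mulFun (y i) * xiOp u j - u • oddTransp tOp i j := by
      rw [← mulFun_y_xiOp u i j h]; abel
    have e3 : mulFun (y j) * mulFun (y i) = mulFun (y i) * mulFun (n := n) (y j) := by
      rw [← map_mul, mul_comm, map_mul]
    have e4 := oddTransp_tOp_xiOp u i j j
    have e5 := oddTransp_tOp_xiOp u i j i
    rw [Equiv.swap_apply_right] at e4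
    rw [Equiv.swap_apply_left] at e5
    calc _ = mulFun (y i) * (xiOp u i * mulFun (y j)) * xiOp u j +
          mulFun (y j) * (xiOp u j * mulFun (y i)) * xiOp u i := by simp only [mul_assoc]
      _ = mulFun (y i) * mulFun (y j) * (xiOp u i * xiOp u j + xiOp u j * xiOp u i) +
          u • (mulFun (y i) * (oddTransp tOp i j * xiOp u j) -
            mulFun (y j) * (oddTransp tOp i j * xiOp u i)) := by
        rw [e1, e2]
        simp only [mul_add, add_mul, mul_sub, sub_mul, ← mul_assoc, e3, mul_smul_comm,
          smul_mul_assoc, smul_sub]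
        abel
      _ = _ := by
        rw [xiOp_mul_xiOp u i j h, e4, e5, neg_add_cancel, mul_zero, zero_add, sub_mul]
        simp only [mul_neg, mul_assoc, smul_sub, smul_neg]
        abel
  unfold zetaOp
  set a := mulFun (y i) * xiOp u i
  set b := mulFun (y j) * xiOp u j
  set M := oddJM tOp i
  set N := oddJM tOp j
  refine eq_neg_of_add_eq_zero_left ?_
  calc (a + u • M) * (b + u • N) + (b + u • N) * (a + u • M)
      = (a * b + b * a) + u • (M * b + b * M) + u • (N * a + a * N) + u • u • (M * N + N * M) := by
        simp only [mul_add, add_mul, mul_smul_comm, smul_mul_assoc, smul_add]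
        abel
    _ = 0 := by
        rw [hX, hN, hM, hMM, neg_add_cancel, neg_add_cancel, smul_zero, smul_zero,
          add_zero, add_zero, ← smul_add, ← add_mul, sub_add_sub_cancel, sub_self, zero_mul,
          smul_zero]

/-- The operators by which the generators of `TrigDaha n u` act. -/
noncomputable def trigGenOp : TrigGen n → RepEnd n
  | .e i => mulFun (y i)
  | .eInv i => mulFun (y i)⁻¹
  | .zeta i => zetaOp u i
  | .t l => tOp l

theorem lift_trigGenOp_gexp (η : Fin n → ℤ) :
    FreeAlgebra.lift ℂ (trigGenOp u) (gexp η) = mulFun (ofLattice (lexp η)) := by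
  rw [gexp, map_list_prod, List.map_ofFn, RatFun.ofLattice_lexp, ← List.prod_ofFn, map_list_prod,
    List.map_ofFn]
  congr 2
  funext i
  simp only [Function.comp_apply, map_mul, map_pow, ge, geInv, FreeAlgebra.lift_ι_apply, trigGenOp]
  rw [← map_pow, ← map_pow, ← map_mul]
  congr 1
  obtain ⟨m, hm | hm⟩ := Int.eq_nat_or_neg (η i) <;> simp [hm]

theorem lift_trigGenOp_glat (q : LatticeAlg n) :
    FreeAlgebra.lift ℂ (trigGenOp u) (glat q) = mulFun (ofLattice q) := by
  rw [glat, RatFun.ofLattice_apply, Finsupp.sum, Finsupp.sum, map_sum, map_sum]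
  refine Finset.sum_congr rfl fun η _ => ?_
  rw [map_smul, map_smul, lift_trigGenOp_gexp]

/-- The representation of `TrigDaha n u` on `RepSpace n`; composed with `ι` it is `rep`. -/
noncomputable def trigRep : TrigDaha n u →ₐ[ℂ] RepEnd n :=
  RingQuot.liftAlgHom ℂ ⟨FreeAlgebra.lift ℂ (trigGenOp u), by
    intro a b hab
    cases hab with
    | spin hs => exact SpinSymRel.map_eq _ (by simpa [gt, trigGenOp] using tOp_rel) hs
    | e_eInv i =>
      simp only [ge, geInv, map_mul, FreeAlgebra.lift_ι_apply, trigGenOp, map_one]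
      rw [← map_mul, mul_inv_cancel₀ (RatFun.y_ne_zero i), map_one]
    | eInv_e i =>
      simp only [ge, geInv, map_mul, FreeAlgebra.lift_ι_apply, trigGenOp, map_one]
      rw [← map_mul, inv_mul_cancel₀ (RatFun.y_ne_zero i), map_one]
    | e_e i j =>
      simp only [ge, map_mul, FreeAlgebra.lift_ι_apply, trigGenOp]
      rw [← map_mul, mul_comm, map_mul]
    | t_e l =>
      simp only [gt, ge, map_mul, FreeAlgebra.lift_ι_apply, trigGenOp]
      rw [tOp_mulFun, RatFun.perm_y, Equiv.swap_apply_left]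
    | t_e' l j h h' =>
      simp only [gt, ge, map_mul, FreeAlgebra.lift_ι_apply, trigGenOp]
      rw [tOp_mulFun, RatFun.perm_y, Equiv.swap_apply_of_ne_of_ne h h']
    | zeta_t l => simpa [gt, gzeta, trigGenOp] using zetaOp_mul_tOp u l
    | zeta_t' l j h h' => simpa [gt, gzeta, trigGenOp] using zetaOp_mul_tOp' u l j h h'
    | zeta_zeta i j h => simpa [gzeta, trigGenOp] using zetaOp_mul_zetaOp u i j h
    | zeta_exp i η q hq =>
      rw [map_sub, map_mul, map_mul, lift_trigGenOp_gexp, map_smul, map_sum]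
      have hz : FreeAlgebra.lift ℂ (trigGenOp u) (gzeta i) = zetaOp u i :=
        FreeAlgebra.lift_ι_apply _ _
      rw [hz, zetaOp_mulFun]
      congr 1
      refine Finset.sum_congr rfl fun k hk => ?_
      have hk : k ≠ i := by simpa using hk
      rw [map_smul, map_mul, lift_trigGenOp_glat, map_oddTransp,
        ← RatFun.sgn_smul_ofLattice hk (hq k hk) rfl, map_smul, smul_mul_assoc]
      simp [gt, trigGenOp]⟩

theorem trigRep_gen (g : TrigGen n) : trigRep u (TrigDaha.gen u g) = trigGenOp u g := by
  unfold trigRep TrigDaha.gen TrigDaha.mk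
  erw [RingQuot.liftAlgHom_mkAlgHom_apply]
  exact FreeAlgebra.lift_ι_apply _ _

theorem trigRep_comp_iota : (trigRep u).comp (iota n u) = rep u := by
  refine RatDaha.hom_ext u (fun i => ?_) (fun i => ?_) (fun l => ?_)
  · have h1 : trigRep u (TrigDaha.eInv u i) = mulFun (y i)⁻¹ := trigRep_gen u (.eInv i)
    have h2 : trigRep u (TrigDaha.zeta u i) = zetaOp u i := trigRep_gen u (.zeta i)
    have h3 : (fun l => trigRep u (TrigDaha.t u l)) = tOp (n := n) :=
      funext fun l => trigRep_gen u (.t l)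
    rw [AlgHom.comp_apply, iota_xi, rep_xi, TrigDaha.xi, TrigDaha.zetaSub, map_mul, map_sub,
      map_smul, map_oddJM, h1, h2, h3, zetaOp, add_sub_cancel_right, ← mul_assoc, ← map_mul,
      inv_mul_cancel₀ (RatFun.y_ne_zero i), map_one, one_mul]
  · rw [AlgHom.comp_apply, iota_y, rep_y]
    exact trigRep_gen u (.e i)
  · rw [AlgHom.comp_apply, iota_t, rep_t]
    exact trigRep_gen u (.t l)

end RepSpace

theorem iota_injective (n : ℕ) (u : ℂ) : Function.Injective (iota n u) := by
  have h := RepSpace.rep_injective (n := n) u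
  rw [← RepSpace.trigRep_comp_iota, AlgHom.coe_comp] at h
  exact h.of_comp

/-! ### Localization at `y_1 ⋯ y_n` -/

section Localization

variable {n : ℕ} (u : ℂ)

theorem TrigDaha.mem_of_gen_mem (s : Subalgebra ℂ (TrigDaha n u)) (he : ∀ i, TrigDaha.e u i ∈ s)
    (hi : ∀ i, TrigDaha.eInv u i ∈ s) (hz : ∀ i, TrigDaha.zeta u i ∈ s)
    (ht : ∀ l, TrigDaha.t u l ∈ s) (x : TrigDaha n u) : x ∈ s := by
  obtain ⟨w, rfl⟩ := RingQuot.mkAlgHom_surjective ℂ (TrigRel n u) x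
  induction w using FreeAlgebra.induction with
  | grade0 c => rw [AlgHom.commutes]; exact s.algebraMap_mem c
  | grade1 g =>
    cases g with
    | e i => exact he i
    | eInv i => exact hi i
    | zeta i => exact hz i
    | t l => exact ht l
  | mul a b ha hb => rw [map_mul]; exact s.mul_mem ha hb
  | add a b ha hb => rw [map_add]; exact s.add_mem ha hb

/-- `ℂ[y_1, …, y_n]` acts on `TrigDaha n u` through `ι` by left multiplication. -/
noncomputable instance : Module (MvPolynomial (Fin n) ℂ) (TrigDaha n u) :=
  Module.compHom _ ((iota n u).comp (RatDaha.polyHom u)).toRingHom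

theorem TrigDaha.poly_smul_def (p : MvPolynomial (Fin n) ℂ) (x : TrigDaha n u) :
    p • x = iota n u (RatDaha.polyHom u p) * x := rfl

instance : IsScalarTower (MvPolynomial (Fin n) ℂ) (TrigDaha n u) (TrigDaha n u) where
  smul_assoc p x z := by
    rw [TrigDaha.poly_smul_def, smul_eq_mul, smul_eq_mul, mul_assoc, TrigDaha.poly_smul_def]

instance : IsScalarTower ℂ (MvPolynomial (Fin n) ℂ) (TrigDaha n u) where
  smul_assoc c p x := by
    rw [TrigDaha.poly_smul_def, map_smul, map_smul, smul_mul_assoc, TrigDaha.poly_smul_def]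

/-- `ι` as a map of `ℂ[y]`-modules. -/
noncomputable def iotaLin : RatDaha n u →ₗ[MvPolynomial (Fin n) ℂ] TrigDaha n u where
  toFun := iota n u
  map_add' := map_add _
  map_smul' p h := by
    rw [RatDaha.poly_smul_def, map_mul, RingHom.id_apply, TrigDaha.poly_smul_def]

theorem isUnit_iota_prodX : IsUnit (iota n u (RatDaha.polyHom u (prodX n))) := by
  unfold prodX
  refine Finset.prod_induction _ (fun p => IsUnit (iota n u (RatDaha.polyHom u p)))
    (fun p q hp hq => ?_) ?_ fun i _ => ?_
  · rw [map_mul, map_mul]; exact hp.mul hq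
  · rw [map_one, map_one]; exact isUnit_one
  · rw [RatDaha.polyHom_X, iota_y]
    exact ⟨⟨_, _, TrigDaha.e_mul_eInv u i, TrigDaha.eInv_mul_e u i⟩, rfl⟩

/-- Every element of `TrigDaha n u` has a denominator `(y_1 ⋯ y_n)^N`. -/
theorem exists_pow_mul_eq_iota (x : TrigDaha n u) :
    ∃ N h, iota n u (RatDaha.polyHom u (prodX n)) ^ N * x = iota n u h := by
  set E := iota n u (RatDaha.polyHom u (prodX n)) with hE
  have hc : ∀ N h, Commute (E ^ N) (iota n u h) := fun N h =>
    ((RatDaha.commute_polyHom_prodX u h).map (iota n u)).pow_left N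
  let s : Subalgebra ℂ (TrigDaha n u) :=
    { carrier := {x | ∃ N h, E ^ N * x = iota n u h}
      mul_mem' := by
        rintro x z ⟨N, h, hx⟩ ⟨M, k, hz⟩
        refine ⟨M + N, h * k, ?_⟩
        rw [pow_add, mul_assoc, ← mul_assoc (E ^ N), hx, ← mul_assoc, (hc M h).eq, mul_assoc, hz,
          map_mul]
      add_mem' := by
        rintro x z ⟨N, h, hx⟩ ⟨M, k, hz⟩
        refine ⟨M + N,
          RatDaha.polyHom u (prodX n) ^ M * h + RatDaha.polyHom u (prodX n) ^ N * k, ?_⟩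
        rw [mul_add, pow_add, mul_assoc, hx, (Commute.pow_pow_self E M N).eq, mul_assoc, hz,
          map_add, map_mul, map_mul, map_pow, map_pow]
      algebraMap_mem' := fun c =>
        ⟨0, algebraMap ℂ _ c, by rw [AlgHom.commutes, pow_zero, one_mul]⟩ }
  have hr : ∀ h, iota n u h ∈ s := fun h => ⟨0, h, by rw [pow_zero, one_mul]⟩
  have hy : ∀ i, TrigDaha.e u i ∈ s := fun i => iota_y u i ▸ hr _
  have ht : ∀ l, TrigDaha.t u l ∈ s := fun l => iota_t u l ▸ hr _
  refine TrigDaha.mem_of_gen_mem u s hy (fun i => ?_) (fun i => ?_) ht x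
  · refine ⟨1, RatDaha.polyHom u (∏ j ∈ Finset.univ.erase i, MvPolynomial.X j), ?_⟩
    rw [pow_one, hE, prodX, ← Finset.prod_erase_mul _ _ (Finset.mem_univ i), map_mul, map_mul,
      RatDaha.polyHom_X, iota_y, mul_assoc, TrigDaha.e_mul_eInv, mul_one]
  · have e : TrigDaha.zeta u i = TrigDaha.e u i * TrigDaha.xi u i + u • oddJM (TrigDaha.t u) i := by
      rw [TrigDaha.xi, ← mul_assoc, TrigDaha.e_mul_eInv, one_mul, TrigDaha.zetaSub, sub_add_cancel]
    rw [e]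
    exact s.add_mem (s.mul_mem (hy i) (iota_xi u i ▸ hr _))
      (s.smul_mem (sum_mem fun k _ => oddTransp_mem s ht k i) u)

instance isLocalizedModule_iotaLin :
    IsLocalizedModule (Submonoid.powers (prodX n)) (iotaLin (n := n) u) where
  map_units := by
    rintro ⟨_, N, rfl⟩
    rw [map_pow]
    refine IsUnit.pow N ((Module.End.isUnit_iff _).mpr ?_)
    exact IsUnit.isUnit_iff_mulLeft_bijective.mp (isUnit_iota_prodX u)
  surj x := by
    obtain ⟨N, h, hx⟩ := exists_pow_mul_eq_iota u x
    refine ⟨(h, ⟨_, N, rfl⟩), ?_⟩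
    change (prodX n ^ N) • x = iota n u h
    rw [TrigDaha.poly_smul_def, map_pow, map_pow, hx]
  exists_of_eq h := ⟨1, congrArg _ (iota_injective n u h)⟩

/-- The isomorphism `ℂ[y^±] ⊗ RatDaha n u ≃ TrigDaha n u` of `ℂ[y]`-modules: both sides are
localizations of `RatDaha n u` at `y_1 ⋯ y_n`. -/
noncomputable def locEquiv : LocRat n u ≃ₗ[MvPolynomial (Fin n) ℂ] TrigDaha n u :=
  IsLocalizedModule.linearEquiv (Submonoid.powers (prodX n))
    (TensorProduct.mk (MvPolynomial (Fin n) ℂ) (Laurent n) (RatDaha n u) 1) (iotaLin u)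

theorem locEquiv_one_tmul (h : RatDaha n u) : locEquiv u (1 ⊗ₜ h) = iota n u h :=
  IsLocalizedModule.linearEquiv_apply (Submonoid.powers (prodX n))
    (TensorProduct.mk (MvPolynomial (Fin n) ℂ) (Laurent n) (RatDaha n u) 1) (iotaLin u) h

theorem locEquiv_mul (f g : Laurent n) (h : RatDaha n u) :
    locEquiv u (f ⊗ₜ 1) * locEquiv u (g ⊗ₜ h) = locEquiv u ((f * g) ⊗ₜ h) := by
  obtain ⟨⟨p, s⟩, hs⟩ := IsLocalization.surj (Submonoid.powers (prodX n)) f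
  -- After multiplication by the denominator `s` of `f`, both sides are `p • locEquiv u (g ⊗ₜ h)`.
  refine IsLocalizedModule.smul_injective (iotaLin u) s ?_
  have hsf : (s : MvPolynomial (Fin n) ℂ) • f = p • (1 : Laurent n) := by
    rw [Algebra.smul_def, Algebra.smul_def, mul_one, mul_comm]; exact hs
  change (s : MvPolynomial (Fin n) ℂ) • (locEquiv u (f ⊗ₜ 1) * locEquiv u (g ⊗ₜ h)) =
    (s : MvPolynomial (Fin n) ℂ) • locEquiv u ((f * g) ⊗ₜ h)
  rw [← smul_mul_assoc, ← map_smul, ← map_smul, TensorProduct.smul_tmul', TensorProduct.smul_tmul',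
    ← smul_mul_assoc, hsf, ← TensorProduct.smul_tmul', map_smul, locEquiv_one_tmul, map_one,
    smul_mul_assoc, one_mul, smul_mul_assoc, one_mul, ← TensorProduct.smul_tmul', map_smul]

/-- The product on `LocRat n u`, transported from `TrigDaha n u`. -/
noncomputable def locMul : LocRat n u →ₗ[ℂ] LocRat n u →ₗ[ℂ] LocRat n u :=
  ((LinearMap.mul ℂ (TrigDaha n u)).compl₁₂
    ((locEquiv u).restrictScalars ℂ).toLinearMap
    ((locEquiv u).restrictScalars ℂ).toLinearMap).compr₂
      ((locEquiv u).restrictScalars ℂ).symm.toLinearMap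

theorem locEquiv_locMul (a b : LocRat n u) :
    locEquiv u (locMul u a b) = locEquiv u a * locEquiv u b :=
  (locEquiv u).apply_symm_apply _

theorem isLocMul_locMul : IsLocMul (locMul (n := n) u) where
  assoc a b c := (locEquiv u).injective (by simp only [locEquiv_locMul, mul_assoc])
  one_mul a := (locEquiv u).injective (by
    rw [locEquiv_locMul, locEquiv_one_tmul, map_one, _root_.one_mul])
  mul_one a := (locEquiv u).injective (by
    rw [locEquiv_locMul, locEquiv_one_tmul, map_one, _root_.mul_one])
  left_mul f g := (locEquiv u).injective (by rw [locEquiv_locMul, locEquiv_mul])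
  right_mul h h' := (locEquiv u).injective (by
    rw [locEquiv_locMul, locEquiv_one_tmul, locEquiv_one_tmul, locEquiv_one_tmul, map_mul])
  left_mul_right f h := (locEquiv u).injective (by
    rw [locEquiv_locMul, locEquiv_mul, _root_.mul_one])

theorem algebraMap_tmul (p : MvPolynomial (Fin n) ℂ) (h : RatDaha n u) :
    (algebraMap _ (Laurent n) p ⊗ₜ h : LocRat n u) = 1 ⊗ₜ (RatDaha.polyHom u p * h) := by
  rw [Algebra.algebraMap_eq_smul_one, TensorProduct.smul_tmul, RatDaha.poly_smul_def]

variable {u}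

/-- Elements of `RatDaha n u` commute with the inverses of powers of the central `y_1 ⋯ y_n`. -/
theorem IsLocMul.mul_inv_comm {m : LocRat n u →ₗ[ℂ] LocRat n u →ₗ[ℂ] LocRat n u} (hm : IsLocMul m)
    {s : MvPolynomial (Fin n) ℂ} (hs : s ∈ Submonoid.powers (prodX n)) {w : Laurent n}
    (hw : w * algebraMap _ _ s = 1) (h : RatDaha n u) :
    m (1 ⊗ₜ h) (w ⊗ₜ 1) = m (w ⊗ₜ 1) (1 ⊗ₜ h) := by
  have hc : Commute (RatDaha.polyHom u s) h := by
    obtain ⟨N, rfl⟩ := hs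
    rw [map_pow]
    exact (RatDaha.commute_polyHom_prodX u h).pow_left N
  have h1 : m (w ⊗ₜ 1) (algebraMap _ (Laurent n) s ⊗ₜ 1) = 1 ⊗ₜ 1 := by rw [hm.left_mul, hw]
  have h2 : m (algebraMap _ (Laurent n) s ⊗ₜ 1) (w ⊗ₜ 1) = 1 ⊗ₜ 1 := by
    rw [hm.left_mul, mul_comm, hw]
  have h3 : m (1 ⊗ₜ h) (algebraMap _ (Laurent n) s ⊗ₜ 1) =
      m (algebraMap _ (Laurent n) s ⊗ₜ 1) (1 ⊗ₜ h) := by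
    rw [algebraMap_tmul, _root_.mul_one, hm.right_mul, hm.right_mul, hc.eq]
  calc m (1 ⊗ₜ h) (w ⊗ₜ 1)
      = m (w ⊗ₜ 1) (m (m (algebraMap _ (Laurent n) s ⊗ₜ 1) (1 ⊗ₜ h)) (w ⊗ₜ 1)) := by
        rw [← hm.assoc, ← hm.assoc, h1, hm.one_mul]
    _ = m (w ⊗ₜ 1) (1 ⊗ₜ h) := by rw [← h3, hm.assoc, h2, hm.mul_one]

theorem IsLocMul.apply_tmul {m : LocRat n u →ₗ[ℂ] LocRat n u →ₗ[ℂ] LocRat n u} (hm : IsLocMul m)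
    {s p : MvPolynomial (Fin n) ℂ} (hs : s ∈ Submonoid.powers (prodX n)) {w f : Laurent n}
    (hw : w * algebraMap _ _ s = 1) (h h' : RatDaha n u) :
    m (f ⊗ₜ h) ((w * algebraMap _ _ p) ⊗ₜ h') = (f * w) ⊗ₜ (h * (RatDaha.polyHom u p * h')) := by
  have h1 : ((w * algebraMap _ (Laurent n) p) ⊗ₜ h' : LocRat n u) =
      m (w ⊗ₜ 1) (1 ⊗ₜ (RatDaha.polyHom u p * h')) := by
    rw [hm.left_mul_right, ← RatDaha.poly_smul_def, ← TensorProduct.smul_tmul, Algebra.smul_def,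
      mul_comm]
  rw [h1, ← hm.left_mul_right, hm.assoc, ← hm.assoc (1 ⊗ₜ h), hm.mul_inv_comm hs hw, hm.assoc,
    hm.right_mul, ← hm.assoc, hm.left_mul, hm.left_mul_right]

theorem IsLocMul.unique {m m' : LocRat n u →ₗ[ℂ] LocRat n u →ₗ[ℂ] LocRat n u} (hm : IsLocMul m)
    (hm' : IsLocMul m') : m = m' := by
  have key : ∀ (f g : Laurent n) (h h' : RatDaha n u),
      m (f ⊗ₜ h) (g ⊗ₜ h') = m' (f ⊗ₜ h) (g ⊗ₜ h') := by
    intro f g h h'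
    obtain ⟨⟨p, s⟩, hs⟩ := IsLocalization.surj (Submonoid.powers (prodX n)) g
    obtain ⟨w, hw⟩ := (IsLocalization.map_units (Laurent n) s).exists_left_inv
    have hg : g = w * algebraMap _ _ p := by
      rw [← hs, mul_left_comm, hw, _root_.mul_one]
    rw [hg, hm.apply_tmul s.2 hw, hm'.apply_tmul s.2 hw]
  refine LinearMap.ext fun a => LinearMap.ext fun b => ?_
  induction a using TensorProduct.induction_on with
  | zero => simp
  | add a a' ha ha' => rw [map_add, map_add, LinearMap.add_apply, LinearMap.add_apply, ha, ha']
  | tmul f h =>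
    induction b using TensorProduct.induction_on with
    | zero => simp
    | add b b' hb hb' => rw [map_add, map_add, hb, hb']
    | tmul g h' => exact key f g h h'

end Localization

end SpinDaha

theorem mainTheorem9 (n : ℕ) (u : ℂ) :
    ∃ ι : SpinDaha.RatDaha n u →ₐ[ℂ] SpinDaha.TrigDaha n u,
      -- existence, uniqueness and injectivity of the superalgebra homomorphism
      SpinDaha.IsIota ι ∧
      (∀ ι' : SpinDaha.RatDaha n u →ₐ[ℂ] SpinDaha.TrigDaha n u, SpinDaha.IsIota ι' → ι' = ι) ∧
      Function.Injective ι ∧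
      -- the algebra `ℂ[y^±] ⊗_{ℂ[y]} RatDaha n u` exists and is uniquely determined
      ∃ m : SpinDaha.LocRat n u →ₗ[ℂ] SpinDaha.LocRat n u →ₗ[ℂ] SpinDaha.LocRat n u,
        SpinDaha.IsLocMul m ∧
        (∀ m' : SpinDaha.LocRat n u →ₗ[ℂ] SpinDaha.LocRat n u →ₗ[ℂ] SpinDaha.LocRat n u,
          SpinDaha.IsLocMul m' → m' = m) ∧
        -- `ι` extends to an algebra isomorphism `φ`, whose inverse is given explicitly
        ∃ φ : SpinDaha.LocRat n u ≃ₗ[ℂ] SpinDaha.TrigDaha n u,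
          φ (1 ⊗ₜ 1) = 1 ∧
          (∀ a b, φ (m a b) = φ a * φ b) ∧
          (∀ h : SpinDaha.RatDaha n u, φ (1 ⊗ₜ h) = ι h) ∧
          (∀ s : SpinDaha.SpinSym n,
            φ.symm (SpinDaha.TrigDaha.ofSpin u s) = 1 ⊗ₜ SpinDaha.RatDaha.ofSpin u s) ∧
          (∀ i : Fin n, φ.symm (SpinDaha.TrigDaha.e u i) = 1 ⊗ₜ SpinDaha.RatDaha.y u i) ∧
          (∀ i : Fin n, φ.symm (SpinDaha.TrigDaha.zeta u i) =
            1 ⊗ₜ (SpinDaha.RatDaha.y u i * SpinDaha.RatDaha.xi u i +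
              u • SpinDaha.RatDaha.ofSpin u (SpinDaha.jucysMurphy i))) := by
  have hφ : ∀ h : SpinDaha.RatDaha n u,
      (SpinDaha.locEquiv u).restrictScalars ℂ (1 ⊗ₜ h) = SpinDaha.iota n u h :=
    SpinDaha.locEquiv_one_tmul u
  refine ⟨SpinDaha.iota n u, SpinDaha.isIota_iota n u, fun _ h => h.eq_iota,
    SpinDaha.iota_injective n u, SpinDaha.locMul u, SpinDaha.isLocMul_locMul u,
    fun _ h => h.unique (SpinDaha.isLocMul_locMul u), (SpinDaha.locEquiv u).restrictScalars ℂ,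
    ?_, SpinDaha.locEquiv_locMul u, hφ, fun s => ?_, fun i => ?_, fun i => ?_⟩
  · rw [hφ, map_one]
  · rw [LinearEquiv.symm_apply_eq, hφ, SpinDaha.iota_ofSpin]
  · rw [LinearEquiv.symm_apply_eq, hφ, SpinDaha.iota_y]
  · rw [LinearEquiv.symm_apply_eq, hφ, map_add, map_mul, map_smul, SpinDaha.iota_ofSpin,
      SpinDaha.iota_y, SpinDaha.iota_xi, SpinDaha.TrigDaha.ofSpin_jucysMurphy,
      SpinDaha.TrigDaha.xi, ← mul_assoc, SpinDaha.TrigDaha.e_mul_eInv, one_mul,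
      SpinDaha.TrigDaha.zetaSub, sub_add_cancel]
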